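/- Let $n\ge 1$, let $\alpha,\beta>0$, let $u_0\in L^2(\mathbb R^n)$, and let $u\in C([0,\infty);L^2(\mathbb R^n))$ be the solution of the free Schrödinger initial value problem $$\partial_t u=i\Delta u\quad (t>0,\ x\in\mathbb R^n),\qquad u(x,0)=u_0(x),$$ where the equation is understood in the sense of distributions in $x$: for every Schwartz function $\varphi$ and every $t>0$, the function $s\mapsto\int_{\mathbb R^n}u(x,s)\varphi(x)\,dx$ is differentiable at $s=t$ with derivative $i\int_{\mathbb R^n}u(x,t)\,\Delta\varphi(x)\,dx$. Write $$\widehat f(\xi)=(2\pi)^{-n/2}\int_{\mathbb R^n}e^{-ix\cdot\xi}f(x)\,dx$$ for the Fourier transform, extended to $L^2(\mathbb R^n)$ by Plancherel's theorem, and for $T>0$ put $$\theta(t)=\frac{\beta(T-t)}{T(\alpha t+\beta)},\qquad \mu(t)=\frac{\beta}{\alpha t+\beta}.$$ Weighted norms $\|\cdot\|_2=\|\cdot\|_{L^2(\mathbb R^n)}$ take values in $[0,\infty]$, with the conventions $a^0=1$ for all $a\in[0,\infty]$ and $0\cdot\infty=0$. Let $\gamma=(\gamma_1,\dots,\gamma_n)\in[0,\infty)^n$.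 Then, for every $T>0$ and every $0\le t\le T$, $$\Big\|e^{\sum_{j}\frac{\gamma_jx_j^2}{(\alpha t+\beta)^2}}u(t)\Big\|_2\le\Big\|e^{\sum_j\frac{\gamma_jx_j^2}{\beta^2}}u(0)\Big\|_2^{\theta(t)}\Big\|e^{\sum_j\frac{\gamma_jx_j^2}{(\alpha T+\beta)^2}}u(T)\Big\|_2^{1-\theta(t)},$$ and, for every $t\ge 0$, $$\Big\|e^{\sum_{j}\frac{\gamma_jx_j^2}{(\alpha t+\beta)^2}}u(t)\Big\|_2\le\Big\|e^{\sum_j\frac{\gamma_jx_j^2}{\beta^2}}u(0)\Big\|_2^{\mu(t)}\Big\|e^{\sum_j\frac{4\gamma_j\xi_j^2}{\alpha^2}}\,\widehat u(0)\Big\|_2^{1-\mu(t)}.$$ In particular, in each inequality the left-hand side is finite whenever the right-hand side is. -/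

import Mathlib

open MeasureTheory
open scoped ENNReal SchwartzMap FourierTransform Laplacian

noncomputable section

/-- `L²(ℝⁿ; ℂ)`. -/
abbrev L2Space (n : ℕ) : Type := Lp ℂ 2 (volume : Measure (EuclideanSpace ℝ (Fin n)))

/-- `u` is the solution in `C([0, ∞); L²(ℝⁿ))` of the free Schrödinger initial value problem
`∂ₜ u = i Δ u` for `t > 0`, `u(0) = u₀`; the equation holds in the sense of tempered
distributions in `x`: for each Schwartz function `φ` and each `t > 0`,
`d/dt ∫ u(x, t) φ(x) dx = i ∫ u(x, t) Δφ(x) dx`. -/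
structure IsFreeSchrodingerSolution {n : ℕ} (u₀ : L2Space n) (u : ℝ → L2Space n) : Prop where
  continuousOn : ContinuousOn u (Set.Ici 0)
  initial : u 0 = u₀
  equation : ∀ φ : 𝓢(EuclideanSpace ℝ (Fin n), ℂ), ∀ t : ℝ, 0 < t →
    HasDerivAt (fun s : ℝ => ∫ x, u s x * φ x) (Complex.I * ∫ x, u t x * (Δ φ) x) t

/-- The Fourier transform on `L²(ℝⁿ)` in the unitary angular-frequency normalization,
`f̂(ξ) = (2π)^(-n/2) ∫ e^(-i x·ξ) f(x) dx`, extended from the Schwartz class by Plancherel.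
Mathlib's `𝓕 f` is the `L²` extension of `η ↦ ∫ e^(-2πi x·η) f(x) dx`, so that
`f̂(ξ) = (2π)^(-n/2) (𝓕 f)(ξ / 2π)`. -/
def angularFourier {n : ℕ} (f : L2Space n) : EuclideanSpace ℝ (Fin n) → ℂ :=
  fun ξ => (((2 * Real.pi) ^ (-(n : ℝ) / 2) : ℝ) : ℂ) * (𝓕 f : L2Space n) ((2 * Real.pi)⁻¹ • ξ)

/-- The weighted norm `‖exp(∑ⱼ cⱼ xⱼ²) f‖_{L²(ℝⁿ)}`, with values in `[0, ∞]`. -/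
def gaussianNorm {n : ℕ} (c : Fin n → ℝ) (f : EuclideanSpace ℝ (Fin n) → ℂ) : ℝ≥0∞ :=
  eLpNorm (fun x => ((Real.exp (∑ j, c j * x j ^ 2) : ℝ) : ℂ) * f x) 2 volume

end

/-! Quadratic weights reduce to linear ones. By the Laplace transform of a centred Gaussian with
variances `γ j`, the square of `‖exp(∑ γ_j r² x_j²) f‖` is the average over `s` of the square of
`‖exp(r s·x) f‖` (`gaussianNorm_sq`). Hölder's inequality in `s` then carries any log-convexity
estimate that is uniform in `s` over to Gaussian weights (`gaussianNorm_le_of_linearNorm_le`).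

For linear weights the free flow acts on phase space by shears. On the Fourier side, `exp(r s·x)` at
time `t` becomes `exp(c·X + d·P)`, with `d` proportional to `r s` and `c` to `t r s`
(`weyl_eq_chirp`, `integral_weyl_chirp`). For `r = 1/(αt+β)` one has `α (t r) + β r = 1`, so all
these exponents lie on one line; `t → ∞` gives `d = 0`, a pure weight in frequency. Both
inequalities therefore follow from one fact: the bound for `exp(c·X + d·P)` is log-convex along
segments of `(c, d)` (`WeylBound.convex`). This is Hadamard's three lines theorem: with a complex
parameter, the imaginary part of the exponent contributes a unitary Weyl operator and an explicit
scalar.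

The operators are unbounded, so all bounds are tested by duality on the span of decaying Gaussians.
These functions extend to `ℂⁿ`, where the operators are explicit, and their span is stable under
Weyl operators, chirps and the Fourier transform. `eLpNorm_le_of_gaussianSpan` recovers a true `L²`
bound, finiteness included. `IsFreeSchrodingerSolution.isChirp` identifies the distributional
solution with the Fourier multiplier. -/

/-- The inclusion `ℝⁿ → ℂⁿ`. -/
def complexify {n : ℕ} (x : EuclideanSpace ℝ (Fin n)) : Fin n → ℂ := fun j => (x j : ℂ)

/-- The Gaussian `ζ ↦ exp(-w ζ·ζ + v·ζ)` as an entire function on `ℂⁿ`. -/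
noncomputable def entireGaussian {n : ℕ} (w : ℂ) (v : Fin n → ℂ) (ζ : Fin n → ℂ) : ℂ :=
  Complex.exp (-w * (ζ ⬝ᵥ ζ) + v ⬝ᵥ ζ)

/-- The span of the entire Gaussians that decay on `ℝⁿ`. -/
def gaussianSpan (n : ℕ) : Submodule ℂ ((Fin n → ℂ) → ℂ) :=
  Submodule.span ℂ {h | ∃ w : ℂ, ∃ v, 0 < w.re ∧ h = entireGaussian w v}

/-- The operator `exp(c·ζ + i d·∂)` on entire functions. -/
noncomputable def weyl {n : ℕ} (c d : Fin n → ℂ) (h : (Fin n → ℂ) → ℂ) (ζ : Fin n → ℂ) : ℂ :=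
  Complex.exp (Complex.I * (c ⬝ᵥ d) / 2 + c ⬝ᵥ ζ) * h (ζ + Complex.I • d)

/-! ### Entire Gaussians, Weyl operators and the Fourier transform -/

section Gaussian

open Complex

variable {n : ℕ}

lemma continuous_complexify : Continuous (complexify (n := n)) := by
  unfold complexify; fun_prop

lemma complexify_add (x y : EuclideanSpace ℝ (Fin n)) :
    complexify (x + y) = complexify x + complexify y := by
  ext j; simp [complexify]

lemma complexify_smul (r : ℝ) (x : EuclideanSpace ℝ (Fin n)) :
    complexify (r • x) = (r : ℂ) • complexify x := by
  ext j; simp [complexify]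

lemma complexify_dotProduct (x y : EuclideanSpace ℝ (Fin n)) :
    complexify x ⬝ᵥ complexify y = ((inner ℝ x y : ℝ) : ℂ) := by
  simp [complexify, dotProduct, PiLp.inner_apply, mul_comm]

lemma entireGaussian_mul (w w' : ℂ) (v v' ζ : Fin n → ℂ) :
    entireGaussian w v ζ * entireGaussian w' v' ζ = entireGaussian (w + w') (v + v') ζ := by
  simp only [entireGaussian, ← Complex.exp_add, add_dotProduct]
  ring_nf

lemma entireGaussian_add (w : ℂ) (v ζ d : Fin n → ℂ) :
    entireGaussian w v (ζ + d) =
      Complex.exp (-w * (d ⬝ᵥ d) + v ⬝ᵥ d) * entireGaussian w (v - (2 * w) • d) ζ := by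
  simp only [entireGaussian, ← Complex.exp_add, add_dotProduct, dotProduct_add, sub_dotProduct,
    smul_dotProduct, smul_eq_mul, dotProduct_comm ζ d]
  ring_nf

lemma entireGaussian_zero (v ζ : Fin n → ℂ) :
    entireGaussian 0 v ζ = Complex.exp (v ⬝ᵥ ζ) := by
  simp [entireGaussian]

/-- The quadratic coefficient `w` is unchanged, so decay on `ℝⁿ` survives for all complex `c`, `d`,
and the remaining data are polynomial in `c`, `d`. This is the source of holomorphy in the three
lines argument. -/
lemma weyl_entireGaussian (c d : Fin n → ℂ) (w : ℂ) (v ζ : Fin n → ℂ) :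
    weyl c d (entireGaussian w v) ζ =
      Complex.exp (I * (c ⬝ᵥ d) / 2 + w * (d ⬝ᵥ d) + I * (v ⬝ᵥ d)) *
        entireGaussian w (v + c - (2 * w * I) • d) ζ := by
  simp only [weyl, entireGaussian, ← Complex.exp_add, add_dotProduct, dotProduct_add,
    sub_dotProduct, smul_dotProduct, dotProduct_smul, smul_eq_mul, dotProduct_comm ζ d]
  ring_nf
  simp only [I_sq]
  ring_nf

/-- The canonical commutation relations: the scalar is half the symplectic form of the two
exponents, times `I`, exponentiated. -/
lemma weyl_weyl (c d c' d' : Fin n → ℂ) (h : (Fin n → ℂ) → ℂ) (ζ : Fin n → ℂ) :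
    weyl c d (weyl c' d' h) ζ =
      Complex.exp (I * (d ⬝ᵥ c' - c ⬝ᵥ d') / 2) * weyl (c + c') (d + d') h ζ := by
  simp only [weyl, ← mul_assoc, ← Complex.exp_add, add_dotProduct, dotProduct_add, dotProduct_smul,
    smul_eq_mul, smul_add, dotProduct_comm d c', add_assoc]
  congr 2
  ring

lemma entireGaussian_mem {w : ℂ} (hw : 0 < w.re) (v : Fin n → ℂ) :
    entireGaussian w v ∈ gaussianSpan n := Submodule.subset_span ⟨w, v, hw, rfl⟩

/-- Linear operators that map decaying Gaussians into the span preserve the span. -/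
lemma gaussianSpan_map_mem (T : ((Fin n → ℂ) → ℂ) →ₗ[ℂ] ((Fin n → ℂ) → ℂ))
    (hT : ∀ w : ℂ, ∀ v, 0 < w.re → T (entireGaussian w v) ∈ gaussianSpan n)
    {h : (Fin n → ℂ) → ℂ} (hh : h ∈ gaussianSpan n) : T h ∈ gaussianSpan n := by
  have : gaussianSpan n ≤ (gaussianSpan n).comap T := by
    refine Submodule.span_le.2 ?_
    rintro _ ⟨w, v, hw, rfl⟩
    exact hT w v hw
  exact this hh

/-- `weyl` as a linear map. -/
noncomputable def weylLinear (c d : Fin n → ℂ) :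
    ((Fin n → ℂ) → ℂ) →ₗ[ℂ] ((Fin n → ℂ) → ℂ) where
  toFun := weyl c d
  map_add' f g := by ext ζ; simp [weyl, mul_add]
  map_smul' a f := by ext ζ; simp [weyl]; ring

lemma weyl_mem (c d : Fin n → ℂ) {h : (Fin n → ℂ) → ℂ} (hh : h ∈ gaussianSpan n) :
    weyl c d h ∈ gaussianSpan n := by
  refine gaussianSpan_map_mem (weylLinear c d) (fun w v hw => ?_) hh
  have : weylLinear c d (entireGaussian w v) =
      Complex.exp (I * (c ⬝ᵥ d) / 2 + w * (d ⬝ᵥ d) + I * (v ⬝ᵥ d)) •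
        entireGaussian w (v + c - (2 * w * I) • d) := by
    ext ζ; exact weyl_entireGaussian c d w v ζ
  rw [this]
  exact Submodule.smul_mem _ _ (entireGaussian_mem hw _)

/-- Multiplication by a function on `ℂⁿ`. -/
noncomputable def mulLinear (g : (Fin n → ℂ) → ℂ) :
    ((Fin n → ℂ) → ℂ) →ₗ[ℂ] ((Fin n → ℂ) → ℂ) where
  toFun h := g * h
  map_add' f g := by ext ζ; simp [mul_add]
  map_smul' a f := by ext ζ; simp; ring

/-- The boundary case `w.re = 0` is the one used: chirps have imaginary `w`, linear exponentials
have `w = 0`. -/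
lemma entireGaussian_mul_mem {w : ℂ} (hw : 0 ≤ w.re) (v : Fin n → ℂ) {h : (Fin n → ℂ) → ℂ}
    (hh : h ∈ gaussianSpan n) : entireGaussian w v * h ∈ gaussianSpan n := by
  refine gaussianSpan_map_mem (mulLinear (entireGaussian w v)) (fun w' v' hw' => ?_) hh
  have : mulLinear (entireGaussian w v) (entireGaussian w' v') =
      entireGaussian (w + w') (v + v') := by
    ext ζ; exact entireGaussian_mul w w' v v' ζ
  rw [this]
  exact entireGaussian_mem (by simp; linarith) _

lemma integrable_entireGaussian {w : ℂ} (hw : 0 < w.re) (v : Fin n → ℂ) :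
    Integrable (fun x : EuclideanSpace ℝ (Fin n) => entireGaussian w v (complexify x)) := by
  rw [← (PiLp.volume_preserving_toLp (Fin n)).integrable_comp_emb
    (MeasurableEquiv.toLp 2 _).measurableEmbedding]
  convert! GaussianFourier.integrable_cexp_neg_mul_sum_add hw v using 3 with y
  simp [entireGaussian, complexify, dotProduct, pow_two]

lemma integral_entireGaussian {w : ℂ} (hw : 0 < w.re) (v : Fin n → ℂ) :
    ∫ x : EuclideanSpace ℝ (Fin n), entireGaussian w v (complexify x) =
      (Real.pi / w) ^ (n / 2 : ℂ) * Complex.exp ((v ⬝ᵥ v) / (4 * w)) := by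
  rw [← (PiLp.volume_preserving_toLp (Fin n)).integral_comp
    (MeasurableEquiv.toLp 2 _).measurableEmbedding]
  have := GaussianFourier.integral_cexp_neg_mul_sum_add hw v
  simp only [Fintype.card_fin] at this
  refine (integral_congr_ae (Filter.Eventually.of_forall fun y => ?_)).trans (this.trans ?_)
  · simp [entireGaussian, complexify, dotProduct, pow_two]
  · simp [dotProduct, pow_two]

lemma fourier_entireGaussian {w : ℂ} (hw : 0 < w.re) (v : Fin n → ℂ)
    (ξ : EuclideanSpace ℝ (Fin n)) :
    𝓕 (fun x : EuclideanSpace ℝ (Fin n) => entireGaussian w v (complexify x)) ξ =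
      (Real.pi / w) ^ (n / 2 : ℂ) * Complex.exp ((v ⬝ᵥ v) / (4 * w)) *
        entireGaussian (Real.pi ^ 2 / w) (-(Real.pi * I / w) • v) (complexify ξ) := by
  have hw0 : w ≠ 0 := by rintro rfl; simp at hw
  rw [Real.fourier_eq']
  have : ∀ x : EuclideanSpace ℝ (Fin n),
      Complex.exp (((-2 * Real.pi * inner ℝ x ξ : ℝ) : ℂ) * I) •
        entireGaussian w v (complexify x) =
      entireGaussian w (v + (-(2 * Real.pi * I)) • complexify ξ) (complexify x) := by
    intro x
    simp only [entireGaussian, smul_eq_mul, ← Complex.exp_add, add_dotProduct, smul_dotProduct,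
      complexify_dotProduct, real_inner_comm x ξ]
    push_cast
    ring_nf
  simp_rw [this]
  rw [integral_entireGaussian hw]
  simp only [mul_assoc ((Real.pi / w : ℂ) ^ (n / 2 : ℂ)), entireGaussian, add_dotProduct, dotProduct_add, smul_dotProduct,
    dotProduct_smul, smul_eq_mul, dotProduct_comm (complexify ξ) v, ← Complex.exp_add]
  congr 2
  field_simp
  ring_nf
  simp only [I_sq]
  ring

lemma norm_entireGaussian (w : ℂ) (v : Fin n → ℂ) (x : EuclideanSpace ℝ (Fin n)) :
    ‖entireGaussian w v (complexify x)‖ = Real.exp (-w.re * ‖x‖ ^ 2 + ∑ j, (v j).re * x j) := by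
  rw [entireGaussian, Complex.norm_exp, complexify_dotProduct]
  simp [complexify, dotProduct, -ofReal_pow]

lemma continuous_entireGaussian (w : ℂ) (v : Fin n → ℂ) : Continuous (entireGaussian w v) := by
  unfold entireGaussian dotProduct; fun_prop

lemma memLp_entireGaussian {w : ℂ} (hw : 0 < w.re) (v : Fin n → ℂ) :
    MemLp (fun x : EuclideanSpace ℝ (Fin n) => entireGaussian w v (complexify x)) 2 := by
  refine (memLp_two_iff_integrable_sq_norm
    (integrable_entireGaussian hw v).aestronglyMeasurable).2 ?_
  refine (integrable_entireGaussian (w := w + w) (by simp [hw]) (v + v)).norm.congr ?_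
  refine Filter.Eventually.of_forall fun x => ?_
  simp only [← entireGaussian_mul, norm_mul, pow_two]

lemma gaussianSpan_integrable {h : (Fin n → ℂ) → ℂ} (hh : h ∈ gaussianSpan n) :
    Integrable (fun x : EuclideanSpace ℝ (Fin n) => h (complexify x)) := by
  induction hh using Submodule.span_induction with
  | mem h hh => obtain ⟨w, v, hw, rfl⟩ := hh; exact integrable_entireGaussian hw v
  | zero => simp
  | add f g _ _ hf hg => exact hf.add hg
  | smul a f _ hf => exact hf.smul a

lemma gaussianSpan_memLp {h : (Fin n → ℂ) → ℂ} (hh : h ∈ gaussianSpan n) :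
    MemLp (fun x : EuclideanSpace ℝ (Fin n) => h (complexify x)) 2 := by
  induction hh using Submodule.span_induction with
  | mem h hh => obtain ⟨w, v, hw, rfl⟩ := hh; exact memLp_entireGaussian hw v
  | zero => simp
  | add f g _ _ hf hg => exact hf.add hg
  | smul a f _ hf => exact hf.const_smul a

lemma gaussianSpan_continuous {h : (Fin n → ℂ) → ℂ} (hh : h ∈ gaussianSpan n) :
    Continuous h := by
  induction hh using Submodule.span_induction with
  | mem h hh => obtain ⟨w, v, hw, rfl⟩ := hh; exact continuous_entireGaussian w v
  | zero => exact continuous_zero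
  | add f g _ _ hf hg => exact hf.add hg
  | smul a f _ hf => exact hf.const_smul a

lemma fourier_add_of_integrable {f g : EuclideanSpace ℝ (Fin n) → ℂ} (hf : Integrable f)
    (hg : Integrable g) (ξ : EuclideanSpace ℝ (Fin n)) : 𝓕 (f + g) ξ = 𝓕 f ξ + 𝓕 g ξ := by
  have := VectorFourier.fourierIntegral_add (μ := volume) (L := innerₗ (EuclideanSpace ℝ (Fin n)))
    Real.continuous_fourierChar continuous_inner hf hg
  exact congrFun this ξ

lemma fourier_smul_fun (a : ℂ) (f : EuclideanSpace ℝ (Fin n) → ℂ)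
    (ξ : EuclideanSpace ℝ (Fin n)) : 𝓕 (a • f) ξ = a • 𝓕 f ξ :=
  congrFun (VectorFourier.fourierIntegral_const_smul Real.fourierChar volume
    (innerₗ (EuclideanSpace ℝ (Fin n))) f a) ξ

/-- The Fourier transform preserves the span of the decaying Gaussians. -/
lemma gaussianSpan_fourier {h : (Fin n → ℂ) → ℂ} (hh : h ∈ gaussianSpan n) :
    ∃ k ∈ gaussianSpan n, ∀ ξ : EuclideanSpace ℝ (Fin n),
      𝓕 (fun x : EuclideanSpace ℝ (Fin n) => h (complexify x)) ξ = k (complexify ξ) := by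
  induction hh using Submodule.span_induction with
  | mem h hh =>
    obtain ⟨w, v, hw, rfl⟩ := hh
    refine ⟨_, Submodule.smul_mem _ _ (entireGaussian_mem (w := Real.pi ^ 2 / w) ?_ _),
      fourier_entireGaussian hw v⟩
    rw [← ofReal_pow, div_eq_mul_inv, re_ofReal_mul, inv_re]
    have : w ≠ 0 := by rintro rfl; simp at hw
    have := normSq_pos.2 this
    positivity
  | zero => exact ⟨0, zero_mem _, fun ξ => by simp [Real.fourier_eq']⟩
  | add f g hfm hgm hf hg =>
    obtain ⟨k, hk, hfk⟩ := hf
    obtain ⟨l, hl, hgl⟩ := hg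
    refine ⟨k + l, add_mem hk hl, fun ξ => ?_⟩
    have := fourier_add_of_integrable (gaussianSpan_integrable hfm) (gaussianSpan_integrable hgm) ξ
    rw [hfk, hgl] at this
    exact this
  | smul a f _ hf =>
    obtain ⟨k, hk, hfk⟩ := hf
    refine ⟨a • k, Submodule.smul_mem _ _ hk, fun ξ => ?_⟩
    have := fourier_smul_fun a (fun x => f (complexify x)) ξ
    rw [hfk] at this
    exact this

/-- The Fourier transform turns an imaginary translation into a real exponential weight. -/
lemma gaussianSpan_fourier_shift {h : (Fin n → ℂ) → ℂ} (hh : h ∈ gaussianSpan n)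
    (d ξ : EuclideanSpace ℝ (Fin n)) :
    𝓕 (fun x : EuclideanSpace ℝ (Fin n) => h (complexify x + I • complexify d)) ξ =
      Complex.exp (-(2 * Real.pi * inner ℝ d ξ : ℝ)) *
        𝓕 (fun x : EuclideanSpace ℝ (Fin n) => h (complexify x)) ξ := by
  have hshift : ∀ f ∈ gaussianSpan n,
      Integrable fun x : EuclideanSpace ℝ (Fin n) => f (complexify x + I • complexify d) := by
    intro f hf
    simpa [weyl] using gaussianSpan_integrable (weyl_mem 0 (complexify d) hf)
  induction hh using Submodule.span_induction with
  | mem h hh =>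
    obtain ⟨w, v, hw, rfl⟩ := hh
    have hw0 : w ≠ 0 := by rintro rfl; simp at hw
    simp_rw [entireGaussian_add]
    have := fourier_smul_fun
      (Complex.exp (-w * (I • complexify d ⬝ᵥ I • complexify d) + v ⬝ᵥ I • complexify d))
      (fun x => entireGaussian w (v - (2 * w) • I • complexify d) (complexify x)) ξ
    refine this.trans ?_
    rw [fourier_entireGaussian hw, fourier_entireGaussian hw, smul_eq_mul]
    simp only [entireGaussian, mul_assoc]
    rw [mul_left_comm, mul_left_comm (Complex.exp (-_))]
    congr 1
    simp only [← Complex.exp_add, sub_dotProduct, dotProduct_sub, smul_dotProduct,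
      dotProduct_smul, smul_eq_mul, dotProduct_comm (complexify d) v, complexify_dotProduct]
    congr 1
    push_cast
    field_simp
    ring_nf
    simp only [I_sq]
    ring
  | zero => simp [Real.fourier_eq']
  | add f g hfm hgm hf hg =>
    have h1 := fourier_add_of_integrable (hshift f hfm) (hshift g hgm) ξ
    have h2 := fourier_add_of_integrable (gaussianSpan_integrable hfm)
      (gaussianSpan_integrable hgm) ξ
    refine h1.trans ?_
    rw [hf, hg, ← mul_add, ← h2]
    rfl
  | smul a f _ hf =>
    refine (fourier_smul_fun a (fun x => f (complexify x + I • complexify d)) ξ).trans ?_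
    rw [hf, smul_eq_mul, mul_left_comm]
    congr 1
    exact (fourier_smul_fun a (fun x => f (complexify x)) ξ).symm

end Gaussian

/-! ### Bilinear Fourier pairing and duality against Gaussians -/

section FourierPairing

variable {n : ℕ}

lemma integral_fourier_mul_of_integrable {f g : EuclideanSpace ℝ (Fin n) → ℂ}
    (hf : Integrable f) (hg : Integrable g) : ∫ ξ, 𝓕 f ξ * g ξ = ∫ x, f x * 𝓕 g x := by
  simpa using! VectorFourier.integral_bilin_fourierIntegral_eq_flip (ContinuousLinearMap.mul ℂ ℂ)
    (L := innerₗ (EuclideanSpace ℝ (Fin n))) (μ := volume) (ν := volume)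
    Real.continuous_fourierChar continuous_inner hf hg

/-- The pairing is bilinear, without conjugation, so that it stays holomorphic in parameters of `k`;
this lemma imports Hilbert space estimates for it. -/
lemma integral_mul_eq_inner {X : Type*} [MeasurableSpace X] {ν : Measure X} {k : X → ℂ}
    (hk : MemLp k 2 ν) (U : Lp ℂ 2 ν) :
    ∫ x, U x * k x ∂ν = inner ℂ (hk.star.toLp (star k)) U := by
  rw [L2.inner_def]
  refine integral_congr_ae ?_
  filter_upwards [hk.star.coeFn_toLp] with x hx
  rw [hx]
  simp

lemma continuous_integral_mul {X : Type*} [MeasurableSpace X] {ν : Measure X} {k : X → ℂ}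
    (hk : MemLp k 2 ν) : Continuous fun U : Lp ℂ 2 ν => ∫ x, U x * k x ∂ν := by
  simp_rw [integral_mul_eq_inner hk]
  fun_prop

lemma norm_integral_mul_le {X : Type*} [MeasurableSpace X] {ν : Measure X} {k : X → ℂ}
    (hk : MemLp k 2 ν) (U : Lp ℂ 2 ν) :
    ‖∫ x, U x * k x ∂ν‖ ≤ ‖U‖ * (eLpNorm k 2 ν).toReal := by
  rw [integral_mul_eq_inner hk, mul_comm]
  refine (norm_inner_le_norm _ _).trans_eq ?_
  rw [Lp.norm_toLp, eLpNorm_star]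

lemma norm_integral_mul_le_of_memLp {X : Type*} [MeasurableSpace X] {ν : Measure X} {f k : X → ℂ}
    (hf : MemLp f 2 ν) (hk : MemLp k 2 ν) :
    ‖∫ x, f x * k x ∂ν‖ ≤ (eLpNorm f 2 ν).toReal * (eLpNorm k 2 ν).toReal := by
  have := norm_integral_mul_le hk (hf.toLp f)
  rw [Lp.norm_toLp] at this
  refine (congrArg norm (integral_congr_ae ?_)).trans_le this
  filter_upwards [hf.coeFn_toLp] with x hx
  rw [hx]

/-- The `L²` Fourier transform is symmetric for the bilinear pairing. -/
lemma integral_fourier_mul (U : L2Space n) {g : EuclideanSpace ℝ (Fin n) → ℂ}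
    (hg : Integrable g) (hg2 : MemLp g 2) (hFg : MemLp (𝓕 g) 2) :
    ∫ x, (𝓕 U : L2Space n) x * g x = ∫ x, U x * 𝓕 g x := by
  refine DenseRange.induction_on
    (p := fun U : L2Space n => ∫ x, (𝓕 U : L2Space n) x * g x = ∫ x, U x * 𝓕 g x)
    (SchwartzMap.denseRange_toLpCLM (F := ℂ) (p := 2) ENNReal.ofNat_ne_top) U ?_ ?_
  · exact isClosed_eq ((continuous_integral_mul hg2).comp
      (Lp.fourierTransformₗᵢ (EuclideanSpace ℝ (Fin n)) ℂ).continuous)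
      (continuous_integral_mul hFg)
  · intro φ
    have h1 : (𝓕 (SchwartzMap.toLpCLM ℝ ℂ 2 volume φ) : L2Space n) = (𝓕 φ).toLp 2 :=
      SchwartzMap.toLp_fourier_eq φ
    rw [h1]
    calc _ = ∫ ξ, 𝓕 φ ξ * g ξ := by
          refine integral_congr_ae ?_
          filter_upwards [(𝓕 φ).coeFn_toLp 2 volume] with x hx
          rw [hx]
      _ = ∫ x, φ x * 𝓕 g x := integral_fourier_mul_of_integrable φ.integrable hg
      _ = _ := by
          refine integral_congr_ae ?_
          filter_upwards [φ.coeFn_toLp 2 volume] with x hx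
          rw [SchwartzMap.toLpCLM_apply, hx]

/-- Pairing the conjugate of `𝓕 g` with `𝓕 g` and moving the transform across gives `‖𝓕 g‖² ≤ ‖𝓕 g‖
‖g‖`, because the `L²` transform is an isometry. -/
lemma eLpNorm_fourier_le {g : EuclideanSpace ℝ (Fin n) → ℂ}
    (hg : Integrable g) (hg2 : MemLp g 2) (hFg : MemLp (𝓕 g) 2) :
    eLpNorm (𝓕 g) 2 ≤ eLpNorm g 2 := by
  set U : L2Space n := hFg.star.toLp (star (𝓕 g)) with hU
  have hUn : ‖U‖ = (eLpNorm (𝓕 g) 2).toReal := by rw [hU, Lp.norm_toLp, eLpNorm_star]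
  have h1 := integral_fourier_mul U hg hg2 hFg
  have h2 := norm_integral_mul_le hg2 (𝓕 U : L2Space n)
  rw [h1, integral_mul_eq_inner hFg, Lp.norm_fourier_eq, ← hU, inner_self_eq_norm_sq_to_K] at h2
  rw [← ENNReal.toReal_le_toReal hFg.2.ne hg2.2.ne, ← hUn]
  rcases (norm_nonneg U).eq_or_lt with h0 | h0
  · rw [← h0]; exact ENNReal.toReal_nonneg
  · have h3 : ‖U‖ * ‖U‖ ≤ ‖U‖ * (eLpNorm g 2).toReal := by simpa [pow_two] using h2
    exact le_of_mul_le_mul_left h3 h0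

/-- Fourier uniqueness for integrable functions. -/
lemma ae_eq_zero_of_fourier_eq_zero {f : EuclideanSpace ℝ (Fin n) → ℂ} (hf : Integrable f)
    (h : ∀ ξ, 𝓕 f ξ = 0) : f =ᵐ[volume] 0 := by
  refine ae_eq_zero_of_integral_contDiff_smul_eq_zero hf.locallyIntegrable fun g hg hgs => ?_
  have hgs' : HasCompactSupport fun x => (g x : ℂ) := hgs.comp_left Complex.ofReal_zero
  set φ : 𝓢(EuclideanSpace ℝ (Fin n), ℂ) :=
    hgs'.toSchwartzMap (Complex.ofRealCLM.contDiff.comp hg)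
  have h3 : ∫ ξ, 𝓕 f ξ * 𝓕⁻ φ ξ = ∫ x, f x * 𝓕 (𝓕⁻ φ) x :=
    integral_fourier_mul_of_integrable hf (𝓕⁻ φ).integrable
  rw [FourierTransform.fourier_fourierInv_eq] at h3
  simp only [h, zero_mul, integral_zero] at h3
  rw [h3]
  refine integral_congr_ae (Filter.Eventually.of_forall fun x => ?_)
  change (g x : ℂ) * f x = f x * (g x : ℂ)
  exact mul_comm _ _

/-- Bounded functionals on the image of a linear map into a Hilbert space are represented by
vectors. -/
lemma exists_inner_eq_of_norm_le {V H : Type*} [AddCommGroup V] [Module ℂ V]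
    [NormedAddCommGroup H] [InnerProductSpace ℂ H] [CompleteSpace H] (T : V →ₗ[ℂ] H)
    (l : V →ₗ[ℂ] ℂ) {M : ℝ} (hM : 0 ≤ M) (h : ∀ x, ‖l x‖ ≤ M * ‖T x‖) :
    ∃ y : H, ‖y‖ ≤ M ∧ ∀ x, l x = inner ℂ y (T x) := by
  -- The bound forces `l` to factor through the range of `T`; Hahn–Banach and Riesz then give the
  -- vector.
  have hker : LinearMap.ker T ≤ LinearMap.ker l := by
    intro x hx
    have := h x
    rw [LinearMap.mem_ker.1 hx, norm_zero, mul_zero] at this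
    exact norm_le_zero_iff.1 this
  let l' : LinearMap.range T →ₗ[ℂ] ℂ :=
    (LinearMap.ker T).liftQ l hker ∘ₗ T.quotKerEquivRange.symm.toLinearMap
  have hl' : ∀ x, l' ⟨T x, LinearMap.mem_range_self T x⟩ = l x := by
    intro x
    have : T.quotKerEquivRange.symm ⟨T x, LinearMap.mem_range_self T x⟩ =
        (LinearMap.ker T).mkQ x := by
      rw [LinearEquiv.symm_apply_eq]; rfl
    simp only [l', LinearMap.comp_apply, LinearEquiv.coe_coe, this]
    rfl
  have hb : ∀ z, ‖l' z‖ ≤ M * ‖z‖ := by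
    rintro ⟨_, x, rfl⟩
    rw [hl']
    exact h x
  obtain ⟨g, hg, hgn⟩ := exists_extension_norm_eq _ (l'.mkContinuous M hb)
  refine ⟨(InnerProductSpace.toDual ℂ H).symm g, ?_, fun x => ?_⟩
  · rw [LinearIsometryEquiv.norm_map, hgn]
    exact LinearMap.mkContinuous_norm_le _ hM _
  · rw [InnerProductSpace.toDual_symm_apply, ← hl']
    exact (hg ⟨T x, LinearMap.mem_range_self T x⟩).symm

/-- A function whose pairings with the Gaussian span are bounded by `M` times the `L²` norm lies
in `L²` with norm at most `M`. -/
lemma eLpNorm_le_of_gaussianSpan {F : EuclideanSpace ℝ (Fin n) → ℂ}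
    (hF : ∀ g ∈ gaussianSpan n, Integrable fun x => F x * g (complexify x)) {M : ℝ} (hM : 0 ≤ M)
    (h : ∀ g ∈ gaussianSpan n,
      ‖∫ x, F x * g (complexify x)‖ ≤ M * (eLpNorm (fun x => g (complexify x)) 2).toReal) :
    eLpNorm F 2 ≤ ENNReal.ofReal M := by
  let T : gaussianSpan n →ₗ[ℂ] L2Space n :=
    { toFun := fun g => (gaussianSpan_memLp g.2).toLp _
      map_add' := fun f g => MemLp.toLp_add (gaussianSpan_memLp f.2) (gaussianSpan_memLp g.2)
      map_smul' := fun a g => MemLp.toLp_const_smul a (gaussianSpan_memLp g.2) }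
  let l : gaussianSpan n →ₗ[ℂ] ℂ :=
    { toFun := fun g => ∫ x, F x * g.1 (complexify x)
      map_add' := fun f g => by
        rw [← integral_add (hF _ f.2) (hF _ g.2)]
        simp [mul_add]
      map_smul' := fun a g => by
        rw [RingHom.id_apply, smul_eq_mul, ← integral_const_mul]
        simp [mul_left_comm] }
  obtain ⟨y, hyM, hy⟩ := exists_inner_eq_of_norm_le T l hM fun g => by
    simpa [T, l, Lp.norm_toLp] using h g.1 g.2
  have hyg : ∀ g ∈ gaussianSpan n, Integrable fun x => star (y x) * g (complexify x) :=
    fun g hg => (Lp.memLp y).star.integrable_mul (gaussianSpan_memLp hg)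
  have key : ∀ g ∈ gaussianSpan n, ∫ x, (F x - star (y x)) * g (complexify x) = 0 := by
    intro g hg
    simp_rw [sub_mul]
    rw [integral_sub (hF g hg) (hyg g hg), sub_eq_zero]
    refine (hy ⟨g, hg⟩).trans ?_
    rw [L2.inner_def]
    refine integral_congr_ae ?_
    filter_upwards [(gaussianSpan_memLp hg).coeFn_toLp] with x hx
    simp only [T, LinearMap.coe_mk, AddHom.coe_mk]
    rw [hx]
    simp [mul_comm]
  have h1 : (0 : ℝ) < (1 : ℂ).re := by simp
  -- The tests `exp(-|x|² - 2πi x·ξ)` belong to the span, so `key` says that the Fourier transform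
  -- of `(F - star y) exp(-|x|²)` vanishes at every `ξ`.
  have hz := ae_eq_zero_of_fourier_eq_zero
    (f := fun x => (F x - star (y x)) * entireGaussian 1 0 (complexify x))
    (by
      simp_rw [sub_mul]
      exact (hF _ (entireGaussian_mem h1 0)).sub (hyg _ (entireGaussian_mem h1 0)))
    (fun ξ => by
      rw [Real.fourier_eq',
        ← key _ (entireGaussian_mem h1 ((-(2 * Real.pi * Complex.I)) • complexify ξ))]
      refine integral_congr_ae (Filter.Eventually.of_forall fun x => ?_)
      simp only [smul_eq_mul]
      rw [mul_left_comm]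
      congr 1
      simp only [entireGaussian, ← Complex.exp_add, smul_dotProduct, zero_dotProduct,
        complexify_dotProduct, smul_eq_mul, real_inner_comm x ξ]
      push_cast
      ring_nf)
  have hFy : F =ᵐ[volume] star (y : EuclideanSpace ℝ (Fin n) → ℂ) := by
    filter_upwards [hz] with x hx
    have : entireGaussian 1 0 (complexify x) ≠ 0 := Complex.exp_ne_zero _
    simpa [this, sub_eq_zero] using hx
  rw [eLpNorm_congr_ae hFy, eLpNorm_star, ← ENNReal.ofReal_toReal (Lp.memLp y).2.ne]
  exact ENNReal.ofReal_le_ofReal hyM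

end FourierPairing

/-! ### The three lines theorem for Weyl operators -/

/-- `exp (c·X + d·P)` is bounded by `M` at `v`, tested by duality against the Gaussian span. -/
def WeylBound {n : ℕ} (v : L2Space n) (c d : EuclideanSpace ℝ (Fin n)) (M : ℝ) : Prop :=
  ∀ h ∈ gaussianSpan n,
    ‖∫ x, v x * weyl (complexify c) (complexify d) h (complexify x)‖ ≤
      M * (eLpNorm (fun x => h (complexify x)) 2).toReal

/-- Growth of order at most two. -/
def QuadraticGrowth (F : ℂ → ℂ) : Prop :=
  ∃ C K : ℝ, 0 ≤ C ∧ 0 ≤ K ∧ ∀ z, ‖F z‖ ≤ C * Real.exp (K * (1 + ‖z‖ ^ 2))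

section ThreeLines

open Complex

variable {n : ℕ}

lemma QuadraticGrowth.add {F G : ℂ → ℂ} (hF : QuadraticGrowth F) (hG : QuadraticGrowth G) :
    QuadraticGrowth fun z => F z + G z := by
  obtain ⟨C, K, hC, hK, h⟩ := hF
  obtain ⟨C', K', hC', hK', h'⟩ := hG
  refine ⟨C + C', K + K', by positivity, by positivity, fun z => ?_⟩
  refine (norm_add_le _ _).trans ((add_le_add (h z) (h' z)).trans ?_)
  rw [add_mul]
  gcongr <;> linarith

lemma QuadraticGrowth.mul {F G : ℂ → ℂ} (hF : QuadraticGrowth F) (hG : QuadraticGrowth G) :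
    QuadraticGrowth fun z => F z * G z := by
  obtain ⟨C, K, hC, hK, h⟩ := hF
  obtain ⟨C', K', hC', hK', h'⟩ := hG
  refine ⟨C * C', K + K', by positivity, by positivity, fun z => ?_⟩
  rw [norm_mul, add_mul, Real.exp_add]
  refine (mul_le_mul (h z) (h' z) (norm_nonneg _) (by positivity)).trans_eq ?_
  ring

lemma QuadraticGrowth.exp_quadratic (a b c : ℂ) :
    QuadraticGrowth fun z => Complex.exp (a + b * z + c * z ^ 2) := by
  refine ⟨1, ‖a‖ + ‖b‖ + ‖c‖, zero_le_one, by positivity, fun z => ?_⟩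
  rw [one_mul]
  refine (norm_exp_le_exp_norm _).trans (Real.exp_le_exp.2 ?_)
  refine (norm_add₃_le).trans ?_
  rw [norm_mul, norm_mul, norm_pow]
  have h1 : ‖z‖ ≤ 1 + ‖z‖ ^ 2 := by nlinarith [sq_nonneg (‖z‖ - 1)]
  nlinarith [norm_nonneg a, norm_nonneg b, norm_nonneg c, sq_nonneg ‖z‖,
    mul_le_mul_of_nonneg_left h1 (norm_nonneg b), mul_nonneg (norm_nonneg a) (sq_nonneg ‖z‖)]

/-- Hadamard's three lines theorem for entire functions of quadratic growth. -/
lemma norm_le_of_three_lines {F : ℂ → ℂ} (hF : Differentiable ℂ F) (hg : QuadraticGrowth F)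
    {A M₀ M₁ : ℝ} (h₀ : 0 < M₀) (h₁ : 0 < M₁) (hF₀ : ∀ z, z.re = 0 → ‖F z‖ ≤ M₀ * A)
    (hF₁ : ∀ z, z.re = 1 → ‖F z‖ ≤ M₁ * A) {θ : ℝ} (hθ₀ : 0 ≤ θ) (hθ₁ : θ ≤ 1) :
    ‖F θ‖ ≤ M₀ ^ (1 - θ) * M₁ ^ θ * A := by
  -- This zero-free factor has modulus `(M₀^(1-x) M₁^x)⁻¹` at real part `x`, so both boundary bounds
  -- become `A`. The term `0 * z ^ 2` fits the form of `QuadraticGrowth.exp_quadratic`.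
  set E : ℂ → ℂ := fun z =>
    Complex.exp (-(Real.log M₀ : ℂ) + ((Real.log M₀ : ℂ) - Real.log M₁) * z + 0 * z ^ 2) with hE
  have hEn : ∀ z, ‖E z‖ = (M₀ ^ (1 - z.re) * M₁ ^ z.re)⁻¹ := by
    intro z
    rw [Real.rpow_def_of_pos h₀, Real.rpow_def_of_pos h₁, ← Real.exp_add, ← Real.exp_neg, hE,
      Complex.norm_exp]
    congr 1
    simp
    ring
  have hEd : Differentiable ℂ E := by rw [hE]; fun_prop
  obtain ⟨C, K, hC, hK, hb⟩ := hg.mul (QuadraticGrowth.exp_quadratic (-(Real.log M₀ : ℂ))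
    ((Real.log M₀ : ℂ) - Real.log M₁) 0)
  have key : ‖F θ * E θ‖ ≤ A := by
    refine PhragmenLindelof.vertical_strip (a := 0) (b := 1) (f := fun z => F z * E z)
      -- A strip of width 1 admits growth `exp(B exp(c |Im z|))` for `c < π`. With `c = 1`,
      -- quadratic growth fits since `1 + ‖z‖² ≤ 2 + |Im z|² ≤ 2 exp |Im z|`.
      (hF.mul hEd).diffContOnCl ⟨1, ?_, 2 * K, ?_⟩ ?_ ?_ ?_ ?_
    · rw [sub_zero, div_one]; linarith [Real.pi_gt_three]
    · refine Asymptotics.IsBigO.of_bound C ?_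
      refine Filter.eventually_inf_principal.2 (Filter.Eventually.of_forall fun z hz => ?_)
      refine (hb z).trans ?_
      rw [Real.norm_of_nonneg (Real.exp_pos _).le]
      refine mul_le_mul_of_nonneg_left (Real.exp_le_exp.2 ?_) hC
      have h2 : ‖z‖ ^ 2 ≤ 1 + |z.im| ^ 2 := by
        have h3 : z.re ^ 2 ≤ 1 := by nlinarith [hz.1, hz.2]
        rw [Complex.sq_norm, normSq_apply, sq_abs]
        nlinarith
      have h4 := Real.quadratic_le_exp_of_nonneg (abs_nonneg z.im)
      rw [one_mul, mul_comm 2 K, mul_assoc]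
      gcongr
      nlinarith [abs_nonneg z.im]
    · intro z hz
      rw [norm_mul, hEn, hz, sub_zero, Real.rpow_one, Real.rpow_zero, mul_one,
        ← div_eq_mul_inv, div_le_iff₀ h₀, mul_comm]
      exact hF₀ z hz
    · intro z hz
      rw [norm_mul, hEn, hz, sub_self, Real.rpow_one, Real.rpow_zero, one_mul,
        ← div_eq_mul_inv, div_le_iff₀ h₁, mul_comm]
      exact hF₁ z hz
    · simpa using hθ₀
    · simpa using hθ₁
  rw [norm_mul, hEn, ofReal_re, ← div_eq_mul_inv, div_le_iff₀ (by positivity)] at key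
  linarith

/-- Exponential integrals with a superexponentially integrable density are entire. -/
lemma differentiable_integral_mul_exp {X : Type*} [MeasurableSpace X] {ν : Measure X}
    {f L : X → ℂ} (hf : AEStronglyMeasurable f ν) (hL : AEStronglyMeasurable L ν)
    (h : ∀ R : ℝ, Integrable (fun x => ‖f x‖ * Real.exp (R * ‖L x‖)) ν) :
    Differentiable ℂ fun z : ℂ => ∫ x, f x * Complex.exp (z * L x) ∂ν := by
  intro z₀
  have hmeas : ∀ z : ℂ, AEStronglyMeasurable (fun x => f x * Complex.exp (z * L x)) ν :=
    fun z => hf.mul (Complex.continuous_exp.comp_aestronglyMeasurable (hL.const_mul z))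
  have hbound : ∀ R : ℝ, ∀ z : ℂ, ‖z‖ ≤ R → ∀ x,
      ‖f x * Complex.exp (z * L x)‖ ≤ ‖f x‖ * Real.exp (R * ‖L x‖) := by
    intro R z hz x
    rw [norm_mul]
    gcongr
    refine (norm_exp_le_exp_norm _).trans (Real.exp_le_exp.2 ?_)
    rw [norm_mul]
    gcongr
  refine (hasDerivAt_integral_of_dominated_loc_of_deriv_le
    (F' := fun z x => f x * (Complex.exp (z * L x) * L x))
    -- One unit covers the ball around `z₀`; the other absorbs the factor `L` of the derivative, by
    -- `‖L‖ ≤ exp ‖L‖`.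
    (bound := fun x => ‖f x‖ * Real.exp ((‖z₀‖ + 2) * ‖L x‖))
    (Metric.ball_mem_nhds z₀ zero_lt_one) (Filter.Eventually.of_forall hmeas) ?_ ?_ ?_ (h _) ?_
    ).2.differentiableAt
  · exact (h ‖z₀‖).mono' (hmeas z₀)
      (Filter.Eventually.of_forall fun x => hbound _ z₀ le_rfl x)
  · simp_rw [← mul_assoc]
    exact (hmeas z₀).mul hL
  · refine Filter.Eventually.of_forall fun x z hz => ?_
    have hz' : ‖z‖ ≤ ‖z₀‖ + 1 := by
      have := norm_le_norm_add_norm_sub' z z₀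
      rw [Metric.mem_ball, dist_eq_norm] at hz
      linarith
    rw [← mul_assoc, norm_mul]
    have h1 : ‖L x‖ ≤ Real.exp ‖L x‖ := by linarith [Real.add_one_le_exp ‖L x‖]
    calc _ ≤ ‖f x‖ * Real.exp ((‖z₀‖ + 1) * ‖L x‖) * Real.exp ‖L x‖ := by
          gcongr
          exact hbound _ z hz' x
      _ = _ := by rw [mul_assoc, ← Real.exp_add]; ring_nf
  · refine Filter.Eventually.of_forall fun x z _ => ?_
    exact (((hasDerivAt_id z).mul_const (L x)).cexp.const_mul (f x)).congr_deriv (by simp)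

lemma exists_norm_dotProduct_le (b : Fin n → ℂ) :
    ∃ B : ℝ, 0 ≤ B ∧ ∀ x : EuclideanSpace ℝ (Fin n), ‖b ⬝ᵥ complexify x‖ ≤ B * ‖x‖ := by
  refine ⟨∑ j, ‖b j‖, by positivity, fun x => ?_⟩
  rw [dotProduct, Finset.sum_mul]
  refine (norm_sum_le _ _).trans (Finset.sum_le_sum fun j _ => ?_)
  rw [norm_mul, complexify, norm_real]
  gcongr
  exact PiLp.norm_apply_le x j

/-- Half of the Gaussian decay absorbs the linear exponential by completing the square. The price
`exp(K R²)` is what produces quadratic growth in the complex parameter. -/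
lemma norm_entireGaussian_mul_exp_le {w : ℂ} (hw : 0 < w.re) (v b : Fin n → ℂ) :
    ∃ K : ℝ, 0 ≤ K ∧ ∀ (R : ℝ) (x : EuclideanSpace ℝ (Fin n)),
      ‖entireGaussian w v (complexify x)‖ * Real.exp (R * ‖b ⬝ᵥ complexify x‖) ≤
        Real.exp (K * R ^ 2) * ‖entireGaussian (w / 2) v (complexify x)‖ := by
  obtain ⟨B, hB, hb⟩ := exists_norm_dotProduct_le b
  refine ⟨B ^ 2 / (2 * w.re), by positivity, fun R x => ?_⟩
  rw [norm_entireGaussian, norm_entireGaussian, ← Real.exp_add, ← Real.exp_add, Real.exp_le_exp]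
  have h2 : (w / 2).re = w.re / 2 := by simp
  have h1 : R * ‖b ⬝ᵥ complexify x‖ ≤ |R| * (B * ‖x‖) :=
    mul_le_mul (le_abs_self R) (hb x) (norm_nonneg _) (abs_nonneg R)
  have h3 : |R| * (B * ‖x‖) ≤ B ^ 2 / (2 * w.re) * R ^ 2 + w.re / 2 * ‖x‖ ^ 2 := by
    have h4 : B ^ 2 / (2 * w.re) * R ^ 2 + w.re / 2 * ‖x‖ ^ 2 - |R| * (B * ‖x‖) =
        (B * |R| - w.re * ‖x‖) ^ 2 / (2 * w.re) := by
      field_simp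
      rw [← sq_abs R]
      ring
    have h5 : 0 ≤ (B * |R| - w.re * ‖x‖) ^ 2 / (2 * w.re) := by positivity
    linarith
  rw [h2]
  linarith

lemma L2_integrable_mul {v : L2Space n} {h : (Fin n → ℂ) → ℂ} (hh : h ∈ gaussianSpan n) :
    Integrable fun x => v x * h (complexify x) :=
  (Lp.memLp v).integrable_mul (gaussianSpan_memLp hh)

/-- On a single Gaussian the pairing is the exponential of a quadratic polynomial in `z` times an
exponential integral; both properties pass to linear combinations. -/
lemma differentiable_quadraticGrowth_weyl (v : L2Space n) (c₀ c₁ d₀ d₁ : Fin n → ℂ)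
    {h : (Fin n → ℂ) → ℂ} (hh : h ∈ gaussianSpan n) :
    (Differentiable ℂ fun z : ℂ =>
      ∫ x, v x * weyl (c₀ + z • c₁) (d₀ + z • d₁) h (complexify x)) ∧
    QuadraticGrowth fun z : ℂ =>
      ∫ x, v x * weyl (c₀ + z • c₁) (d₀ + z • d₁) h (complexify x) := by
  induction hh using Submodule.span_induction with
  | mem h hh =>
    obtain ⟨w, u, hw, rfl⟩ := hh
    set l := u + c₀ - (2 * w * I) • d₀
    set b := c₁ - (2 * w * I) • d₁
    -- Coefficients in `z` of the scalar exponent of `weyl_entireGaussian`; the linear exponent of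
    -- the Gaussian is `l + z b`.
    set q₀ : ℂ := I * (c₀ ⬝ᵥ d₀) / 2 + w * (d₀ ⬝ᵥ d₀) + I * (u ⬝ᵥ d₀)
    set q₁ : ℂ := I * (c₀ ⬝ᵥ d₁ + c₁ ⬝ᵥ d₀) / 2 + 2 * w * (d₀ ⬝ᵥ d₁) + I * (u ⬝ᵥ d₁)
    set q₂ : ℂ := I * (c₁ ⬝ᵥ d₁) / 2 + w * (d₁ ⬝ᵥ d₁)
    have heq : ∀ z : ℂ,
        ∫ x, v x * weyl (c₀ + z • c₁) (d₀ + z • d₁) (entireGaussian w u) (complexify x) =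
        Complex.exp (q₀ + q₁ * z + q₂ * z ^ 2) *
          ∫ x, v x * entireGaussian w l (complexify x) *
            Complex.exp (z * (b ⬝ᵥ complexify x)) := by
      intro z
      rw [← integral_const_mul]
      refine integral_congr_ae (Filter.Eventually.of_forall fun x => ?_)
      simp only [weyl_entireGaussian]
      rw [mul_assoc (v x), mul_left_comm _ (v x)]
      congr 1
      simp only [entireGaussian, ← Complex.exp_add, l, b, q₀, q₁, q₂, add_dotProduct,
        dotProduct_add, sub_dotProduct, smul_dotProduct, dotProduct_smul, smul_eq_mul,
        dotProduct_comm d₁ d₀]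
      congr 1
      ring
    simp_rw [heq]
    obtain ⟨K, hK, hle⟩ := norm_entireGaussian_mul_exp_le hw l b
    have hw2 : 0 < (w / 2).re := by simpa using hw
    have hint : Integrable fun x => ‖v x‖ * ‖entireGaussian (w / 2) l (complexify x)‖ :=
      (L2_integrable_mul (v := v) (entireGaussian_mem hw2 l)).norm.congr
        (Filter.Eventually.of_forall fun x => norm_mul _ _)
    have hL : Continuous fun x : EuclideanSpace ℝ (Fin n) => b ⬝ᵥ complexify x := by
      unfold dotProduct complexify; fun_prop
    have hfm : AEStronglyMeasurable (fun x => v x * entireGaussian w l (complexify x)) :=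
      (L2_integrable_mul (entireGaussian_mem hw l)).aestronglyMeasurable
    have hbd : ∀ (R : ℝ) (x : EuclideanSpace ℝ (Fin n)),
        ‖v x * entireGaussian w l (complexify x)‖ * Real.exp (R * ‖b ⬝ᵥ complexify x‖) ≤
        Real.exp (K * R ^ 2) * (‖v x‖ * ‖entireGaussian (w / 2) l (complexify x)‖) := by
      intro R x
      rw [norm_mul, mul_assoc, mul_left_comm (Real.exp _)]
      exact mul_le_mul_of_nonneg_left (hle R x) (norm_nonneg _)
    constructor
    · refine Differentiable.mul (by fun_prop) ?_
      refine differentiable_integral_mul_exp hfm hL.aestronglyMeasurable fun R => ?_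
      refine (hint.const_mul (Real.exp (K * R ^ 2))).mono' ?_
        (Filter.Eventually.of_forall fun x => ?_)
      · exact hfm.norm.mul (by fun_prop : Continuous fun x : EuclideanSpace ℝ (Fin n) =>
          Real.exp (R * ‖b ⬝ᵥ complexify x‖)).aestronglyMeasurable
      · rw [Real.norm_of_nonneg (by positivity)]
        exact hbd R x
    · refine (QuadraticGrowth.exp_quadratic q₀ q₁ q₂).mul
        ⟨∫ x, ‖v x‖ * ‖entireGaussian (w / 2) l (complexify x)‖, K,
          integral_nonneg fun x => by positivity, hK, fun z => ?_⟩
      rw [mul_comm, ← integral_const_mul]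
      refine norm_integral_le_of_norm_le (hint.const_mul _)
        (Filter.Eventually.of_forall fun x => ?_)
      calc _ ≤ ‖v x * entireGaussian w l (complexify x)‖ *
            Real.exp (‖z‖ * ‖b ⬝ᵥ complexify x‖) := by
            rw [norm_mul _ (Complex.exp _)]
            gcongr
            exact (norm_exp_le_exp_norm _).trans_eq (by rw [norm_mul])
        _ ≤ _ := hbd _ _
        _ ≤ _ := by gcongr; linarith
  | zero =>
    simp only [weyl, Pi.zero_apply, mul_zero, integral_zero]
    exact ⟨differentiable_const 0, 0, 0, le_rfl, le_rfl, fun z => by simp⟩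
  | add f g hfm hgm hf hg =>
    have heq : ∀ z : ℂ, ∫ x, v x * weyl (c₀ + z • c₁) (d₀ + z • d₁) (f + g) (complexify x) =
        (∫ x, v x * weyl (c₀ + z • c₁) (d₀ + z • d₁) f (complexify x)) +
        ∫ x, v x * weyl (c₀ + z • c₁) (d₀ + z • d₁) g (complexify x) := by
      intro z
      rw [← integral_add (L2_integrable_mul (weyl_mem _ _ hfm))
        (L2_integrable_mul (weyl_mem _ _ hgm))]
      simp [weyl, mul_add]
    simp_rw [heq]
    exact ⟨hf.1.add hg.1, hf.2.add hg.2⟩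
  | smul a f hfm hf =>
    have heq : ∀ z : ℂ, ∫ x, v x * weyl (c₀ + z • c₁) (d₀ + z • d₁) (a • f) (complexify x) =
        a * ∫ x, v x * weyl (c₀ + z • c₁) (d₀ + z • d₁) f (complexify x) := by
      intro z
      rw [← integral_const_mul]
      simp [weyl, mul_left_comm]
    simp_rw [heq]
    refine ⟨hf.1.const_mul a, QuadraticGrowth.mul ⟨‖a‖, 0, norm_nonneg a, le_rfl, ?_⟩ hf.2⟩
    simp

/-- Imaginary Weyl operators are isometric. -/
lemma eLpNorm_weyl_imaginary (a b : EuclideanSpace ℝ (Fin n)) (η : ℝ) {h : (Fin n → ℂ) → ℂ}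
    (hh : h ∈ gaussianSpan n) :
    eLpNorm (fun x => weyl ((η * I) • complexify a) ((η * I) • complexify b) h (complexify x)) 2 =
      eLpNorm (fun x => h (complexify x)) 2 := by
  have h1 := eLpNorm_comp_measurePreserving (p := 2)
    (gaussianSpan_integrable hh).aestronglyMeasurable
    (measurePreserving_sub_right (volume : Measure (EuclideanSpace ℝ (Fin n))) (η • b))
  rw [← h1]
  refine eLpNorm_congr_norm_ae (Filter.Eventually.of_forall fun x => ?_)
  -- For an imaginary exponent the imaginary translation becomes a real one, which preserves
  -- Lebesgue measure; the scalar factor is unimodular.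
  have h2 : complexify x + I • (η * I) • complexify b = complexify (x - η • b) := by
    rw [sub_eq_add_neg, complexify_add, ← neg_smul, complexify_smul, smul_smul]
    congr 2
    rw [mul_left_comm, I_mul_I]
    simp
  rw [weyl, norm_mul, h2, Complex.norm_exp]
  simp only [smul_dotProduct, dotProduct_smul, complexify_dotProduct, smul_eq_mul]
  have h3 : (I * (η * I * (η * I * (inner ℝ a b : ℝ))) / 2 +
      η * I * (inner ℝ a x : ℝ) : ℂ).re = 0 := by
    have : (I * (η * I * (η * I * (inner ℝ a b : ℝ))) / 2 + η * I * (inner ℝ a x : ℝ) : ℂ) =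
        ((-η * η * inner ℝ a b / 2 + η * inner ℝ a x : ℝ) : ℂ) * I := by
      push_cast
      ring_nf
      simp only [I_pow_three]
      ring
    rw [this]
    simp
  rw [h3, Real.exp_zero, one_mul]
  rfl

/-- Logarithmic convexity of `M` in the linear exponent. -/
theorem WeylBound.convex {v : L2Space n} {c₀ c₁ d₀ d₁ : EuclideanSpace ℝ (Fin n)} {M₀ M₁ : ℝ}
    (h₀ : 0 < M₀) (h₁ : 0 < M₁) (hv₀ : WeylBound v c₀ d₀ M₀) (hv₁ : WeylBound v c₁ d₁ M₁)
    {θ : ℝ} (hθ₀ : 0 ≤ θ) (hθ₁ : θ ≤ 1) :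
    WeylBound v (c₀ + θ • (c₁ - c₀)) (d₀ + θ • (d₁ - d₀)) (M₀ ^ (1 - θ) * M₁ ^ θ) := by
  intro h hh
  have hg := differentiable_quadraticGrowth_weyl v (complexify c₀) (complexify (c₁ - c₀))
    (complexify d₀) (complexify (d₁ - d₀)) hh
  set J : ℂ → ℂ := fun z => ∫ x, v x * weyl (complexify c₀ + z • complexify (c₁ - c₀))
    (complexify d₀ + z • complexify (d₁ - d₀)) h (complexify x) with hJ
  -- The symplectic form of a point of the segment with its direction is constant along the segment.
  set ω : ℝ := inner ℝ d₀ (c₁ - c₀) - inner ℝ c₀ (d₁ - d₀) with hω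
  -- The exponent at `z` splits into a real one at `z.re` and an imaginary one, up to the scalar of
  -- `weyl_weyl`, which the entire factor `exp(I ω z / 2)` reproduces in modulus. The boundary lines
  -- thus inherit the endpoint bounds, the imaginary operator being isometric.
  have hline : ∀ z : ℂ, ‖Complex.exp (0 + (I * ω / 2) * z + 0 * z ^ 2) * J z‖ =
      ‖∫ x, v x * weyl (complexify (c₀ + z.re • (c₁ - c₀))) (complexify (d₀ + z.re • (d₁ - d₀)))
        (weyl ((z.im * I) • complexify (c₁ - c₀)) ((z.im * I) • complexify (d₁ - d₀)) h)
          (complexify x)‖ := by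
    intro z
    have hsum : ∀ a b : EuclideanSpace ℝ (Fin n), complexify (a + z.re • b) +
        (z.im * I) • complexify b = complexify a + z • complexify b := by
      intro a b
      rw [complexify_add, complexify_smul, add_assoc, ← add_smul, re_add_im]
    simp_rw [weyl_weyl, hsum, mul_left_comm _ (Complex.exp _)]
    rw [integral_const_mul, norm_mul, norm_mul, Complex.norm_exp, Complex.norm_exp]
    congr 2
    simp only [dotProduct_smul, complexify_dotProduct, inner_add_left, inner_smul_left, hω]
    simp [real_inner_comm (d₁ - d₀) (c₁ - c₀)]
    ring
  have hmem := fun z : ℂ => weyl_mem ((z.im * I) • complexify (c₁ - c₀))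
    ((z.im * I) • complexify (d₁ - d₀)) hh
  have := norm_le_of_three_lines
    (F := fun z => Complex.exp (0 + (I * ω / 2) * z + 0 * z ^ 2) * J z)
    (A := (eLpNorm (fun x => h (complexify x)) 2).toReal)
    (Differentiable.mul (by fun_prop) hg.1) ((QuadraticGrowth.exp_quadratic _ _ _).mul hg.2)
    h₀ h₁ (fun z hz => by
      rw [hline z, hz, zero_smul, zero_smul, add_zero, add_zero]
      refine (hv₀ _ (hmem z)).trans_eq ?_
      rw [eLpNorm_weyl_imaginary _ _ _ hh])
    (fun z hz => by
      rw [hline z, hz, one_smul, one_smul, add_sub_cancel, add_sub_cancel]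
      refine (hv₁ _ (hmem z)).trans_eq ?_
      rw [eLpNorm_weyl_imaginary _ _ _ hh]) hθ₀ hθ₁
  rw [hline] at this
  simpa [weyl] using this

end ThreeLines

/-! ### Linear exponential weights along the free flow -/

/-- The norm `‖exp(s·x) f‖` in `L²`, with values in `[0, ∞]`. -/
noncomputable def linearNorm {n : ℕ} (s : EuclideanSpace ℝ (Fin n))
    (f : EuclideanSpace ℝ (Fin n) → ℂ) : ℝ≥0∞ :=
  eLpNorm (fun x => ((Real.exp (inner ℝ s x) : ℝ) : ℂ) * f x) 2 volume

/-- `U` is the free evolution at time `τ / (4 π²)` of the state with Fourier transform `v`. -/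
def IsChirp {n : ℕ} (v : L2Space n) (τ : ℝ) (U : L2Space n) : Prop :=
  (𝓕 U : L2Space n) =ᵐ[volume] fun η => Complex.exp (-(Complex.I * τ * ‖η‖ ^ 2)) * v η

section LinearWeight

open Complex

variable {n : ℕ}

/-- Translating the chirp by `I d` creates a real factor `exp(2τ d·η)` and a constant phase; the
choice `c = -2τ d` cancels both. This is the shear of phase space by the free flow. -/
lemma weyl_eq_chirp (τ : ℝ) (d η : EuclideanSpace ℝ (Fin n)) (k : (Fin n → ℂ) → ℂ) :
    weyl (complexify (-(2 * τ) • d)) (complexify d) (entireGaussian (I * τ) 0 * k)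
      (complexify η) =
    Complex.exp (-(I * τ * ‖η‖ ^ 2)) * k (complexify η + I • complexify d) := by
  simp only [weyl, Pi.mul_apply, entireGaussian, ← mul_assoc, ← Complex.exp_add, complexify_smul,
    zero_dotProduct, add_dotProduct, dotProduct_add, dotProduct_smul, smul_dotProduct, smul_eq_mul,
    complexify_dotProduct, real_inner_comm η d, real_inner_self_eq_norm_sq]
  congr 2
  push_cast
  ring_nf
  simp only [I_pow_three, I_sq]
  ring

lemma eLpNorm_chirp_mul (τ : ℝ) (k : (Fin n → ℂ) → ℂ) :
    eLpNorm (fun x : EuclideanSpace ℝ (Fin n) =>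
      (entireGaussian (I * τ) 0 * k : (Fin n → ℂ) → ℂ) (complexify x)) 2 =
      eLpNorm (fun x : EuclideanSpace ℝ (Fin n) => k (complexify x)) 2 := by
  refine eLpNorm_congr_norm_ae (Filter.Eventually.of_forall fun x => ?_)
  simp only [Pi.mul_apply, norm_mul, norm_entireGaussian]
  simp

lemma chirp_mul_mem (τ : ℝ) {k : (Fin n → ℂ) → ℂ} (hk : k ∈ gaussianSpan n) :
    entireGaussian (I * τ) 0 * k ∈ gaussianSpan n :=
  entireGaussian_mul_mem (by simp) 0 hk

lemma gaussianSpan_memLp_fourier {k : (Fin n → ℂ) → ℂ} (hk : k ∈ gaussianSpan n) :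
    MemLp (𝓕 fun x : EuclideanSpace ℝ (Fin n) => k (complexify x)) 2 := by
  obtain ⟨l, hl, hkl⟩ := gaussianSpan_fourier hk
  rw [funext hkl]
  exact gaussianSpan_memLp hl

/-- Parseval for chirped states against imaginary translates. -/
lemma integral_weyl_chirp {v U : L2Space n} {τ : ℝ} (hU : IsChirp v τ U)
    (d : EuclideanSpace ℝ (Fin n)) {k : (Fin n → ℂ) → ℂ} (hk : k ∈ gaussianSpan n) :
    ∫ η, v η * weyl (complexify (-(2 * τ) • d)) (complexify d) (entireGaussian (I * τ) 0 * k)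
      (complexify η) =
    ∫ x, ((Real.exp (inner ℝ (-(2 * Real.pi) • d) x) : ℝ) : ℂ) * U x *
      𝓕 (fun y : EuclideanSpace ℝ (Fin n) => k (complexify y)) x := by
  have hs : (fun ζ => k (ζ + I • complexify d)) ∈ gaussianSpan n := by
    have hw : (fun ζ => k (ζ + I • complexify d)) = weyl 0 (complexify d) k := by
      ext ζ; simp [weyl]
    rw [hw]
    exact weyl_mem 0 (complexify d) hk
  calc _ = ∫ η, (𝓕 U : L2Space n) η * k (complexify η + I • complexify d) := by
        refine integral_congr_ae ?_
        filter_upwards [hU] with η hη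
        rw [hη, weyl_eq_chirp]
        ring
    _ = _ := by
        rw [integral_fourier_mul U (gaussianSpan_integrable hs) (gaussianSpan_memLp hs)
          (gaussianSpan_memLp_fourier hs)]
        refine integral_congr_ae (Filter.Eventually.of_forall fun x => ?_)
        simp only [gaussianSpan_fourier_shift hk, inner_smul_left]
        push_cast
        simp
        ring

/-- With `linearNorm_le_of_weylBound` this makes a weighted norm at one time equivalent to a Weyl
bound on the common datum `v`, so different times become comparable. -/
lemma weylBound_of_linearNorm {v U : L2Space n} {τ : ℝ} (hU : IsChirp v τ U)
    (d : EuclideanSpace ℝ (Fin n)) {M : ℝ} (hM : 0 ≤ M)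
    (h : linearNorm (-(2 * Real.pi) • d) U ≤ ENNReal.ofReal M) :
    WeylBound v (-(2 * τ) • d) d M := by
  intro h' hh'
  have hinv : entireGaussian (I * τ) 0 * (entireGaussian (I * (-τ : ℝ)) 0 * h') = h' := by
    ext ζ
    simp [← mul_assoc, entireGaussian, ← Complex.exp_add]
  have hk := chirp_mul_mem (-τ) hh'
  rw [← hinv, integral_weyl_chirp hU d hk, eLpNorm_chirp_mul]
  have hmem : MemLp (fun x => ((Real.exp (inner ℝ (-(2 * Real.pi) • d) x) : ℝ) : ℂ) * U x) 2 := by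
    refine ⟨?_, h.trans_lt ENNReal.ofReal_lt_top⟩
    exact (by fun_prop : Continuous fun x : EuclideanSpace ℝ (Fin n) =>
      ((Real.exp (inner ℝ (-(2 * Real.pi) • d) x) : ℝ) : ℂ)).aestronglyMeasurable.mul
        (Lp.aestronglyMeasurable U)
  refine (norm_integral_mul_le_of_memLp hmem (gaussianSpan_memLp_fourier hk)).trans ?_
  refine mul_le_mul (ENNReal.toReal_le_of_le_ofReal hM h) ?_ ENNReal.toReal_nonneg hM
  exact ENNReal.toReal_mono (gaussianSpan_memLp hk).2.ne
    (eLpNorm_fourier_le (gaussianSpan_integrable hk) (gaussianSpan_memLp hk)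
      (gaussianSpan_memLp_fourier hk))

lemma gaussianSpan_neg_mem {k : (Fin n → ℂ) → ℂ} (hk : k ∈ gaussianSpan n) :
    (fun ζ => k (-ζ)) ∈ gaussianSpan n := by
  induction hk using Submodule.span_induction with
  | mem h hh =>
    obtain ⟨w, v, hw, rfl⟩ := hh
    have : (fun ζ => entireGaussian w v (-ζ)) = entireGaussian w (-v) := by
      ext ζ; simp [entireGaussian]
    rw [this]
    exact entireGaussian_mem hw _
  | zero => exact zero_mem _
  | add f g _ _ hf hg => exact add_mem hf hg
  | smul a f _ hf => exact Submodule.smul_mem _ a hf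

lemma complexify_neg (x : EuclideanSpace ℝ (Fin n)) : complexify (-x) = -complexify x := by
  ext j; simp [complexify]

/-- The Fourier transform maps the Gaussian span onto itself, with norm control. -/
lemma exists_fourier_eq {g : (Fin n → ℂ) → ℂ} (hg : g ∈ gaussianSpan n) :
    ∃ k ∈ gaussianSpan n,
      (∀ ξ : EuclideanSpace ℝ (Fin n),
        𝓕 (fun x : EuclideanSpace ℝ (Fin n) => k (complexify x)) ξ = g (complexify ξ)) ∧
      eLpNorm (fun x : EuclideanSpace ℝ (Fin n) => k (complexify x)) 2 ≤
        eLpNorm (fun x : EuclideanSpace ℝ (Fin n) => g (complexify x)) 2 := by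
  obtain ⟨l, hl, hgl⟩ := gaussianSpan_fourier hg
  set G : EuclideanSpace ℝ (Fin n) → ℂ := fun x => g (complexify x) with hG
  have hk : (fun x : EuclideanSpace ℝ (Fin n) => l (-complexify x)) = 𝓕⁻ G := by
    ext x
    rw [Real.fourierInv_eq_fourier_neg, hgl, complexify_neg]
  refine ⟨_, gaussianSpan_neg_mem hl, fun ξ => ?_, ?_⟩
  · rw [hk]
    have hc : Continuous G := (gaussianSpan_continuous hg).comp continuous_complexify
    have hi : Integrable (𝓕 G) := by
      rw [funext hgl]
      exact gaussianSpan_integrable hl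
    exact congrFun (hc.fourier_fourierInv_eq (gaussianSpan_integrable hg) hi) ξ
  · have h1 : (fun x : EuclideanSpace ℝ (Fin n) => l (-complexify x)) = 𝓕 G ∘ Neg.neg := by
      ext x
      simp [hgl, complexify_neg]
    rw [h1, eLpNorm_comp_measurePreserving (gaussianSpan_memLp_fourier hg).1
      (Measure.measurePreserving_neg volume)]
    exact eLpNorm_fourier_le (gaussianSpan_integrable hg) (gaussianSpan_memLp hg)
      (gaussianSpan_memLp_fourier hg)

lemma linearNorm_le_of_weylBound {v U : L2Space n} {τ : ℝ} (hU : IsChirp v τ U)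
    (d : EuclideanSpace ℝ (Fin n)) {M : ℝ} (hM : 0 ≤ M)
    (h : WeylBound v (-(2 * τ) • d) d M) :
    linearNorm (-(2 * Real.pi) • d) U ≤ ENNReal.ofReal M := by
  refine eLpNorm_le_of_gaussianSpan (fun g hg => ?_) hM fun g hg => ?_
  · have := L2_integrable_mul (v := U)
      (entireGaussian_mul_mem (w := 0) le_rfl (complexify (-(2 * Real.pi) • d)) hg)
    refine this.congr (Filter.Eventually.of_forall fun x => ?_)
    simp only [Pi.mul_apply, entireGaussian_zero, complexify_dotProduct]
    push_cast
    ring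
  · obtain ⟨k, hk, hkg, hle⟩ := exists_fourier_eq hg
    simp_rw [← hkg]
    rw [← integral_weyl_chirp hU d hk]
    refine (h _ (chirp_mul_mem τ hk)).trans ?_
    rw [eLpNorm_chirp_mul, funext hkg]
    gcongr
    exact (gaussianSpan_memLp hg).2.ne

lemma weylBound_of_linearNorm_frequency {v : L2Space n} (c : EuclideanSpace ℝ (Fin n)) {M : ℝ}
    (hM : 0 ≤ M) (h : linearNorm c v ≤ ENNReal.ofReal M) : WeylBound v c 0 M := by
  intro k hk
  have hmem : MemLp (fun x => ((Real.exp (inner ℝ c x) : ℝ) : ℂ) * v x) 2 := by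
    refine ⟨?_, h.trans_lt ENNReal.ofReal_lt_top⟩
    exact (by fun_prop : Continuous fun x : EuclideanSpace ℝ (Fin n) =>
      ((Real.exp (inner ℝ c x) : ℝ) : ℂ)).aestronglyMeasurable.mul (Lp.aestronglyMeasurable v)
  have h0 : complexify (0 : EuclideanSpace ℝ (Fin n)) = 0 := by ext; simp [complexify]
  have heq : ∫ x, v x * weyl (complexify c) (complexify 0) k (complexify x) =
      ∫ x, ((Real.exp (inner ℝ c x) : ℝ) : ℂ) * v x * k (complexify x) := by
    refine integral_congr_ae (Filter.Eventually.of_forall fun x => ?_)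
    simp only [h0, weyl, dotProduct_zero, complexify_dotProduct, smul_zero, add_zero, mul_zero,
      zero_div, zero_add]
    push_cast
    ring
  rw [heq]
  refine (norm_integral_mul_le_of_memLp hmem (gaussianSpan_memLp hk)).trans ?_
  gcongr
  exact ENNReal.toReal_le_of_le_ofReal hM h

/-- Passage from real bounds to a multiplicative inequality in `[0, ∞]`. -/
lemma le_rpow_mul_rpow_of_forall {A A₀ A₁ : ℝ≥0∞} {θ : ℝ} (hθ₀ : 0 < θ) (hθ₁ : θ < 1)
    (h₀ : A₀ = 0 → A = 0) (h₁ : A₁ = 0 → A = 0)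
    (h : ∀ M₀ M₁ : ℝ, 0 < M₀ → 0 < M₁ → A₀ ≤ ENNReal.ofReal M₀ → A₁ ≤ ENNReal.ofReal M₁ →
      A ≤ ENNReal.ofReal (M₀ ^ (1 - θ) * M₁ ^ θ)) :
    A ≤ A₀ ^ (1 - θ) * A₁ ^ θ := by
  have hθ' : 0 < 1 - θ := sub_pos.2 hθ₁
  -- Zero factors are treated before infinite ones: they force `A = 0`, which makes the convention
  -- `0 * ∞ = 0` harmless.
  by_cases hA₀ : A₀ = 0
  · simp [h₀ hA₀]
  by_cases hA₁ : A₁ = 0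
  · simp [h₁ hA₁]
  by_cases hA₀t : A₀ = ⊤
  · rw [hA₀t, ENNReal.top_rpow_of_pos hθ', ENNReal.top_mul]
    · exact le_top
    · simp [ENNReal.rpow_eq_zero_iff, hA₁, hθ₀.not_gt]
  by_cases hA₁t : A₁ = ⊤
  · rw [hA₁t, ENNReal.top_rpow_of_pos hθ₀, ENNReal.mul_top]
    · exact le_top
    · simp [ENNReal.rpow_eq_zero_iff, hA₀, hA₀t]
  have := h A₀.toReal A₁.toReal (ENNReal.toReal_pos hA₀ hA₀t) (ENNReal.toReal_pos hA₁ hA₁t)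
    (ENNReal.ofReal_toReal hA₀t).ge (ENNReal.ofReal_toReal hA₁t).ge
  rwa [ENNReal.ofReal_mul (by positivity),
    ← ENNReal.ofReal_rpow_of_nonneg ENNReal.toReal_nonneg hθ'.le,
    ← ENNReal.ofReal_rpow_of_nonneg ENNReal.toReal_nonneg hθ₀.le, ENNReal.ofReal_toReal hA₀t,
    ENNReal.ofReal_toReal hA₁t] at this

lemma linearNorm_eq_zero_iff (s : EuclideanSpace ℝ (Fin n)) (U : L2Space n) :
    linearNorm s U = 0 ↔ U = 0 := by
  have hm : AEStronglyMeasurable (fun x => ((Real.exp (inner ℝ s x) : ℝ) : ℂ) * U x) volume :=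
    (by fun_prop : Continuous fun x : EuclideanSpace ℝ (Fin n) =>
      ((Real.exp (inner ℝ s x) : ℝ) : ℂ)).aestronglyMeasurable.mul (Lp.aestronglyMeasurable U)
  rw [linearNorm, eLpNorm_eq_zero_iff hm two_ne_zero, Lp.eq_zero_iff_ae_eq_zero]
  refine Filter.eventually_congr (Filter.Eventually.of_forall fun x => ?_)
  simp [Real.exp_ne_zero, -ofReal_exp]

/-- Settles the vanishing norms, for which the three lines theorem with positive bounds says
nothing. -/
lemma IsChirp.eq_zero_iff {v U : L2Space n} {τ : ℝ} (hU : IsChirp v τ U) : U = 0 ↔ v = 0 := by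
  have h1 : U = 0 ↔ (𝓕 U : L2Space n) = 0 :=
    ((Lp.fourierTransformₗᵢ (EuclideanSpace ℝ (Fin n)) ℂ).map_eq_zero_iff (x := U)).symm
  rw [h1, Lp.eq_zero_iff_ae_eq_zero, Lp.eq_zero_iff_ae_eq_zero]
  constructor <;> intro h <;> filter_upwards [hU, h] with x hx hx' <;> simp_all

/-- Logarithmic convexity of linear exponential weights between two times. -/
lemma linearNorm_convex_time {v U₀ U₁ U : L2Space n} {τ₀ τ₁ τ : ℝ} (hU₀ : IsChirp v τ₀ U₀)
    (hU₁ : IsChirp v τ₁ U₁) (hU : IsChirp v τ U) {θ : ℝ} (hθ₀ : 0 < θ) (hθ₁ : θ < 1)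
    {r₀ r₁ r : ℝ} (hr : r = r₀ + θ * (r₁ - r₀))
    (hτ : τ * r = τ₀ * r₀ + θ * (τ₁ * r₁ - τ₀ * r₀)) (s : EuclideanSpace ℝ (Fin n)) :
    linearNorm (r • s) U ≤ linearNorm (r₀ • s) U₀ ^ (1 - θ) * linearNorm (r₁ • s) U₁ ^ θ := by
  refine le_rpow_mul_rpow_of_forall hθ₀ hθ₁ ?_ ?_ fun M₀ M₁ hM₀ hM₁ h₀ h₁ => ?_
  · rw [linearNorm_eq_zero_iff, linearNorm_eq_zero_iff, hU₀.eq_zero_iff, hU.eq_zero_iff]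
    exact id
  · rw [linearNorm_eq_zero_iff, linearNorm_eq_zero_iff, hU₁.eq_zero_iff, hU.eq_zero_iff]
    exact id
  -- Imaginary translation by `d` in frequency is the weight `exp(-2π d·x)`, so `d = -r s / (2π)`.
  have hs : ∀ r : ℝ, r • s = -(2 * Real.pi) • (-(r / (2 * Real.pi))) • s := by
    intro r
    rw [smul_smul]
    congr 1
    field_simp
  rw [hs] at h₀ h₁ ⊢
  have := (weylBound_of_linearNorm hU₀ _ hM₀.le h₀).convex hM₀ hM₁
    (weylBound_of_linearNorm hU₁ _ hM₁.le h₁) hθ₀.le hθ₁.le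
  refine linearNorm_le_of_weylBound hU _ (by positivity) ?_
  convert this using 1
  · simp only [smul_smul, ← sub_smul, ← add_smul]
    congr 1
    field_simp
    linarith
  · simp only [smul_smul, ← sub_smul, ← add_smul]
    congr 1
    rw [hr]
    ring

/-- Logarithmic convexity of linear exponential weights between a time and the frequency side. -/
lemma linearNorm_convex_frequency {v U₀ U : L2Space n} {τ₀ τ : ℝ} (hU₀ : IsChirp v τ₀ U₀)
    (hU : IsChirp v τ U) {θ : ℝ} (hθ₀ : 0 < θ) (hθ₁ : θ < 1) {r₀ r₁ r : ℝ}
    (hr : r = (1 - θ) * r₀) (hτ : τ * r = (1 - θ) * (τ₀ * r₀) + θ * (Real.pi * r₁))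
    (s : EuclideanSpace ℝ (Fin n)) :
    linearNorm (r • s) U ≤ linearNorm (r₀ • s) U₀ ^ (1 - θ) * linearNorm (r₁ • s) v ^ θ := by
  refine le_rpow_mul_rpow_of_forall hθ₀ hθ₁ ?_ ?_ fun M₀ M₁ hM₀ hM₁ h₀ h₁ => ?_
  · rw [linearNorm_eq_zero_iff, linearNorm_eq_zero_iff, hU₀.eq_zero_iff, hU.eq_zero_iff]
    exact id
  · rw [linearNorm_eq_zero_iff, linearNorm_eq_zero_iff, hU.eq_zero_iff]
    exact id
  have hs : ∀ r : ℝ, r • s = -(2 * Real.pi) • (-(r / (2 * Real.pi))) • s := by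
    intro r
    rw [smul_smul]
    congr 1
    field_simp
  rw [hs] at h₀ ⊢
  have := (weylBound_of_linearNorm hU₀ _ hM₀.le h₀).convex hM₀ hM₁
    (weylBound_of_linearNorm_frequency _ hM₁.le h₁) hθ₀.le hθ₁.le
  refine linearNorm_le_of_weylBound hU _ (by positivity) ?_
  convert this using 1
  · simp only [smul_smul, ← sub_smul, ← add_smul]
    congr 1
    field_simp
    linarith
  · simp only [smul_smul, zero_sub, ← neg_smul, ← add_smul]
    congr 1
    rw [hr]
    ring

end LinearWeight

/-! ### From linear to quadratic weights by Gaussian averaging -/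

section GaussianAverage

open ProbabilityTheory

variable {n : ℕ}

lemma eLpNorm_two_sq {X : Type*} [MeasurableSpace X] {ν : Measure X} (f : X → ℂ) :
    eLpNorm f 2 ν ^ (2 : ℝ) = ∫⁻ x, ‖f x‖ₑ ^ (2 : ℝ) ∂ν := by
  rw [eLpNorm_eq_lintegral_rpow_enorm_toReal two_ne_zero ENNReal.ofNat_ne_top, ← ENNReal.rpow_mul]
  simp

lemma enorm_exp_mul_sq (a : ℝ) (z : ℂ) :
    ‖((Real.exp a : ℝ) : ℂ) * z‖ₑ ^ (2 : ℝ) =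
      ENNReal.ofReal (Real.exp (2 * a)) * ‖z‖ₑ ^ (2 : ℝ) := by
  rw [enorm_mul, ENNReal.mul_rpow_of_nonneg _ _ zero_le_two]
  congr 1
  rw [← ofReal_norm, Complex.norm_real, Real.norm_of_nonneg (Real.exp_pos a).le,
    ENNReal.ofReal_rpow_of_nonneg (Real.exp_pos a).le zero_le_two, Real.rpow_two, ← Real.exp_nat_mul]
  norm_num

/-- Laplace transform of a centred Gaussian vector with independent coordinates. -/
lemma lintegral_exp_pi_gaussianReal (σ : Fin n → NNReal) (a : Fin n → ℝ) :
    ∫⁻ s, ENNReal.ofReal (Real.exp (∑ j, a j * s j)) ∂(Measure.pi fun j => gaussianReal 0 (σ j)) =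
      ENNReal.ofReal (Real.exp (∑ j, σ j * a j ^ 2 / 2)) := by
  have hint : ∀ j, Integrable (fun s : ℝ => Real.exp (a j * s)) (gaussianReal 0 (σ j)) :=
    fun j => integrable_exp_mul_gaussianReal (a j)
  have h := integral_fintype_prod_eq_prod (𝕜 := ℝ) (μ := fun j => gaussianReal 0 (σ j))
    (fun j s => Real.exp (a j * s))
  simp_rw [Real.exp_sum]
  rw [← ofReal_integral_eq_lintegral_ofReal (Integrable.fintype_prod hint)
    (Filter.Eventually.of_forall fun s => by positivity), h]
  congr 1
  refine Finset.prod_congr rfl fun j _ => ?_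
  have := mgf_gaussianReal (p := gaussianReal 0 (σ j)) (X := id) (μ := 0) (v := σ j)
    Measure.map_id (a j)
  simpa [mgf] using this

lemma linearNorm_sq (s : EuclideanSpace ℝ (Fin n)) (f : EuclideanSpace ℝ (Fin n) → ℂ) :
    linearNorm s f ^ (2 : ℝ) =
      ∫⁻ x, ENNReal.ofReal (Real.exp (2 * inner ℝ s x)) * ‖f x‖ₑ ^ (2 : ℝ) := by
  rw [linearNorm, eLpNorm_two_sq]
  simp_rw [enorm_exp_mul_sq]

lemma aemeasurable_linear_weight (r : ℝ) (ν : Measure (Fin n → ℝ)) [SFinite ν]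
    {f : EuclideanSpace ℝ (Fin n) → ℂ} (hf : AEStronglyMeasurable f volume) :
    AEMeasurable (fun p : (Fin n → ℝ) × EuclideanSpace ℝ (Fin n) =>
      ENNReal.ofReal (Real.exp (2 * inner ℝ (r • WithLp.toLp 2 p.1) p.2)) *
        ‖f p.2‖ₑ ^ (2 : ℝ)) (ν.prod volume) := by
  refine AEMeasurable.mul ?_ (hf.comp_snd.enorm.pow_const 2)
  exact (by fun_prop : Measurable fun p : (Fin n → ℝ) × EuclideanSpace ℝ (Fin n) =>
    ENNReal.ofReal (Real.exp (2 * inner ℝ (r • WithLp.toLp 2 p.1) p.2))).aemeasurable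

lemma aemeasurable_linearNorm_sq (r : ℝ) (ν : Measure (Fin n → ℝ)) [SFinite ν]
    {f : EuclideanSpace ℝ (Fin n) → ℂ} (hf : AEStronglyMeasurable f volume) :
    AEMeasurable (fun s : Fin n → ℝ => linearNorm (r • WithLp.toLp 2 s) f ^ (2 : ℝ)) ν := by
  simp_rw [linearNorm_sq]
  exact (aemeasurable_linear_weight r ν hf).lintegral_prod_right'

/-- Quadratic exponential weights are Gaussian averages of linear exponential weights. -/
lemma gaussianNorm_sq (γ : Fin n → NNReal) (r : ℝ) {f : EuclideanSpace ℝ (Fin n) → ℂ}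
    (hf : AEStronglyMeasurable f volume) :
    gaussianNorm (fun j => γ j * r ^ 2) f ^ (2 : ℝ) =
      ∫⁻ s, linearNorm (r • WithLp.toLp 2 s) f ^ (2 : ℝ)
        ∂(Measure.pi fun j => gaussianReal 0 (γ j)) := by
  simp_rw [linearNorm_sq]
  rw [lintegral_lintegral_swap (aemeasurable_linear_weight r _ hf), gaussianNorm, eLpNorm_two_sq]
  refine lintegral_congr fun x => ?_
  rw [enorm_exp_mul_sq, lintegral_mul_const'' _ (by
    exact (by fun_prop : Measurable fun s : Fin n → ℝ =>
      ENNReal.ofReal (Real.exp (2 * inner ℝ (r • WithLp.toLp 2 s) x))).aemeasurable)]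
  congr 1
  -- Variance `γ j` at argument `2 r x_j` gives `γ_j (2 r x_j)² / 2 = 2 γ_j r² x_j²`, the exponent
  -- of the squared weight. A zero `γ j` is a Dirac mass and needs no separate case.
  have h := lintegral_exp_pi_gaussianReal γ fun j => 2 * r * x j
  have h1 : 2 * ∑ j, (γ j : ℝ) * r ^ 2 * x j ^ 2 = ∑ j, (γ j : ℝ) * (2 * r * x j) ^ 2 / 2 := by
    rw [Finset.mul_sum]
    exact Finset.sum_congr rfl fun j _ => by ring
  have h2 : ∀ s : Fin n → ℝ,
      2 * inner ℝ (r • WithLp.toLp 2 s) x = ∑ j, 2 * r * x j * s j := by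
    intro s
    simp only [PiLp.inner_apply, Finset.mul_sum, PiLp.smul_apply]
    refine Finset.sum_congr rfl fun j _ => ?_
    simp
    ring
  rw [h1, ← h]
  simp_rw [h2]

/-- Linear log-convexity implies Gaussian log-convexity. -/
lemma gaussianNorm_le_of_linearNorm_le (γ : Fin n → NNReal) {r r₀ r₁ θ : ℝ} (hθ₀ : 0 ≤ θ)
    (hθ₁ : θ ≤ 1) {f f₀ f₁ : EuclideanSpace ℝ (Fin n) → ℂ} (hf : AEStronglyMeasurable f volume)
    (hf₀ : AEStronglyMeasurable f₀ volume) (hf₁ : AEStronglyMeasurable f₁ volume)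
    (h : ∀ s, linearNorm (r • s) f ≤
      linearNorm (r₀ • s) f₀ ^ (1 - θ) * linearNorm (r₁ • s) f₁ ^ θ) :
    gaussianNorm (fun j => γ j * r ^ 2) f ≤
      gaussianNorm (fun j => γ j * r₀ ^ 2) f₀ ^ (1 - θ) *
        gaussianNorm (fun j => γ j * r₁ ^ 2) f₁ ^ θ := by
  have hθ' : 0 ≤ 1 - θ := sub_nonneg.2 hθ₁
  -- After squaring, Hölder with weights `1 - θ` and `θ` bounds the average of the product.
  rw [← ENNReal.rpow_le_rpow_iff (zero_lt_two (α := ℝ)),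
    ENNReal.mul_rpow_of_nonneg _ _ zero_le_two, ← ENNReal.rpow_mul, ← ENNReal.rpow_mul,
    mul_comm (1 - θ), mul_comm θ, ENNReal.rpow_mul, ENNReal.rpow_mul, gaussianNorm_sq γ r hf,
    gaussianNorm_sq γ r₀ hf₀, gaussianNorm_sq γ r₁ hf₁]
  refine le_trans (lintegral_mono fun s => ?_) (ENNReal.lintegral_mul_norm_pow_le
    (aemeasurable_linearNorm_sq r₀ _ hf₀) (aemeasurable_linearNorm_sq r₁ _ hf₁) hθ' hθ₀
    (sub_add_cancel 1 θ))
  have := ENNReal.rpow_le_rpow (h (WithLp.toLp 2 s)) (zero_le_two (α := ℝ))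
  rwa [ENNReal.mul_rpow_of_nonneg _ _ zero_le_two, ← ENNReal.rpow_mul, ← ENNReal.rpow_mul,
    mul_comm (1 - θ), mul_comm θ, ENNReal.rpow_mul, ENNReal.rpow_mul] at this

end GaussianAverage

/-! ### The free evolution as a Fourier multiplier -/

/-- The phase `exp(4 π² i r |η|²)`. -/
noncomputable def schrodingerPhase {n : ℕ} (r : ℝ) (η : EuclideanSpace ℝ (Fin n)) : ℂ :=
  Complex.exp (Complex.I * ((r * (4 * Real.pi ^ 2 * ‖η‖ ^ 2) : ℝ) : ℂ))

section Evolution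

open Complex

variable {n : ℕ}

lemma integral_fourier_mul_schwartz (U : L2Space n) (φ : 𝓢(EuclideanSpace ℝ (Fin n), ℂ)) :
    ∫ x, (𝓕 U : L2Space n) x * φ x = ∫ x, U x * (𝓕 φ) x :=
  integral_fourier_mul U φ.integrable (φ.memLp 2 volume) ((𝓕 φ).memLp 2 volume)

/-- On the Fourier side the Laplacian is multiplication by `-4 π² |η|²`. -/
lemma laplacian_fourier (φ ψ : 𝓢(EuclideanSpace ℝ (Fin n), ℂ))
    (h : ∀ η, ψ η = ((-(4 * Real.pi ^ 2 * ‖η‖ ^ 2) : ℝ) : ℂ) * φ η) : Δ (𝓕 φ) = 𝓕 ψ := by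
  have h1 : ∀ η, (𝓕 (𝓕 φ)) (-η) = φ η := by
    intro η
    have := congrArg (fun f : 𝓢(EuclideanSpace ℝ (Fin n), ℂ) => f η)
      (FourierTransform.fourierInv_fourier_eq (F := 𝓢(EuclideanSpace ℝ (Fin n), ℂ)) φ)
    simp only [SchwartzMap.fourierInv_coe] at this
    rw [Real.fourierInv_eq_fourier_neg] at this
    exact this
  rw [SchwartzMap.laplacian_eq_fourierMultiplierCLM, SchwartzMap.fourierMultiplierCLM_apply]
  ext x
  rw [smul_apply, SchwartzMap.fourierInv_coe, Real.fourierInv_eq_fourier_comp_neg,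
    SchwartzMap.fourier_coe]
  have h2 : (ψ : EuclideanSpace ℝ (Fin n) → ℂ) = ((-(2 * Real.pi) ^ 2 : ℝ) : ℂ) • fun η =>
      (SchwartzMap.smulLeftCLM ℂ (fun η : EuclideanSpace ℝ (Fin n) => ‖η‖ ^ 2) (𝓕 (𝓕 φ))) (-η) := by
    ext η
    rw [h, Pi.smul_apply, SchwartzMap.smulLeftCLM_apply_apply (by fun_prop), h1, norm_neg]
    simp
    ring
  rw [h2, fourier_smul_fun]
  simp

lemma norm_schrodingerPhase (r : ℝ) (η : EuclideanSpace ℝ (Fin n)) :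
    ‖schrodingerPhase r η‖ = 1 := by
  rw [schrodingerPhase, mul_comm, norm_exp_ofReal_mul_I]

lemma schrodingerPhase_zero (η : EuclideanSpace ℝ (Fin n)) : schrodingerPhase 0 η = 1 := by
  simp [schrodingerPhase]

lemma norm_schrodingerPhase_sub_le (r s : ℝ) (η : EuclideanSpace ℝ (Fin n)) :
    ‖schrodingerPhase r η - schrodingerPhase s η‖ ≤ |r - s| * (4 * Real.pi ^ 2 * ‖η‖ ^ 2) := by
  have h1 : schrodingerPhase r η - schrodingerPhase s η = schrodingerPhase s η *
      (Complex.exp (I * (((r - s) * (4 * Real.pi ^ 2 * ‖η‖ ^ 2) : ℝ) : ℂ)) - 1) := by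
    rw [mul_sub, mul_one, schrodingerPhase, schrodingerPhase, ← Complex.exp_add]
    congr 2
    push_cast
    ring
  rw [h1, norm_mul, norm_schrodingerPhase, one_mul]
  refine Real.norm_exp_I_mul_ofReal_sub_one_le.trans_eq ?_
  rw [norm_mul, Real.norm_eq_abs, Real.norm_of_nonneg (by positivity)]

lemma contDiff_schrodingerPhase (r : ℝ) :
    ContDiff ℝ ((⊤ : ℕ∞) : WithTop ℕ∞) (schrodingerPhase (n := n) r) := by
  unfold schrodingerPhase
  have h1 : ContDiff ℝ ((⊤ : ℕ∞) : WithTop ℕ∞) fun η : EuclideanSpace ℝ (Fin n) =>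
      r * (4 * Real.pi ^ 2 * ‖η‖ ^ 2) := by
    have := contDiff_norm_sq ℝ (E := EuclideanSpace ℝ (Fin n)) (n := ((⊤ : ℕ∞) : WithTop ℕ∞))
    fun_prop
  exact (contDiff_const.mul (ofRealCLM.contDiff.comp h1)).cexp

lemma hasDerivAt_schrodingerPhase (r : ℝ) (η : EuclideanSpace ℝ (Fin n)) :
    HasDerivAt (fun s => schrodingerPhase s η)
      (schrodingerPhase r η * (I * ((4 * Real.pi ^ 2 * ‖η‖ ^ 2 : ℝ) : ℂ))) r := by
  have h1 : HasDerivAt (fun s : ℝ => I * ((s * (4 * Real.pi ^ 2 * ‖η‖ ^ 2) : ℝ) : ℂ))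
      (I * ((4 * Real.pi ^ 2 * ‖η‖ ^ 2 : ℝ) : ℂ)) r := by
    have := ((hasDerivAt_id r).mul_const (4 * Real.pi ^ 2 * ‖η‖ ^ 2)).ofReal_comp.const_mul I
    simpa using this
  exact h1.cexp

/-- A smooth compactly supported function, as a Schwartz function, times a smooth factor. -/
noncomputable def cutoff {p : EuclideanSpace ℝ (Fin n) → ℂ}
    (hp : ContDiff ℝ ((⊤ : ℕ∞) : WithTop ℕ∞) p) {g : EuclideanSpace ℝ (Fin n) → ℝ}
    (hg : ContDiff ℝ ((⊤ : ℕ∞) : WithTop ℕ∞) g) (hgs : HasCompactSupport g) :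
    𝓢(EuclideanSpace ℝ (Fin n), ℂ) :=
  HasCompactSupport.toSchwartzMap (f := fun x => p x * (g x : ℂ))
    (HasCompactSupport.mul_left (hgs.comp_left Complex.ofReal_zero))
    (hp.mul (ofRealCLM.contDiff.comp hg))

lemma cutoff_apply {p : EuclideanSpace ℝ (Fin n) → ℂ}
    (hp : ContDiff ℝ ((⊤ : ℕ∞) : WithTop ℕ∞) p) {g : EuclideanSpace ℝ (Fin n) → ℝ}
    (hg : ContDiff ℝ ((⊤ : ℕ∞) : WithTop ℕ∞) g) (hgs : HasCompactSupport g)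
    (x : EuclideanSpace ℝ (Fin n)) : cutoff hp hg hgs x = p x * (g x : ℂ) := rfl

lemma contDiff_symbol : ContDiff ℝ ((⊤ : ℕ∞) : WithTop ℕ∞) fun η : EuclideanSpace ℝ (Fin n) =>
    ((4 * Real.pi ^ 2 * ‖η‖ ^ 2 : ℝ) : ℂ) := by
  have := contDiff_norm_sq ℝ (E := EuclideanSpace ℝ (Fin n)) (n := ((⊤ : ℕ∞) : WithTop ℕ∞))
  exact ofRealCLM.contDiff.comp (contDiff_const.mul this)

lemma hasDerivAt_integral_phase (v : L2Space n) {g : EuclideanSpace ℝ (Fin n) → ℝ}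
    (hg : ContDiff ℝ ((⊤ : ℕ∞) : WithTop ℕ∞) g) (hgs : HasCompactSupport g) (t : ℝ) :
    HasDerivAt (fun s => ∫ η, v η * cutoff (contDiff_schrodingerPhase s) hg hgs η)
      (∫ η, v η * (cutoff (contDiff_schrodingerPhase t) hg hgs η *
        (I * ((4 * Real.pi ^ 2 * ‖η‖ ^ 2 : ℝ) : ℂ)))) t := by
  have hint : ∀ φ : 𝓢(EuclideanSpace ℝ (Fin n), ℂ), Integrable fun η => v η * φ η :=
    fun φ => (Lp.memLp v).integrable_mul (φ.memLp 2 volume)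
  refine (hasDerivAt_integral_of_dominated_loc_of_deriv_le
    (F' := fun s η => v η * (cutoff (contDiff_schrodingerPhase s) hg hgs η *
        (I * ((4 * Real.pi ^ 2 * ‖η‖ ^ 2 : ℝ) : ℂ))))
    (bound := fun η => ‖v η * cutoff contDiff_symbol hg hgs η‖) Filter.univ_mem
    (Filter.Eventually.of_forall fun s => (hint _).aestronglyMeasurable) (hint _) ?_ ?_
    (hint _).norm ?_).2
  · refine (Lp.aestronglyMeasurable v).mul (Continuous.aestronglyMeasurable ?_)
    exact (SchwartzMap.continuous _).mul (continuous_const.mul (by fun_prop))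
  · refine Filter.Eventually.of_forall fun η s _ => le_of_eq ?_
    simp only [cutoff_apply, norm_mul, norm_schrodingerPhase, norm_I, one_mul]
    ring
  · refine Filter.Eventually.of_forall fun η s _ => ?_
    simp only [cutoff_apply]
    have := ((hasDerivAt_schrodingerPhase s η).mul_const (g η : ℂ)).const_mul (v η)
    refine this.congr_deriv ?_
    ring

/-- The cutoff makes the phase Lipschitz in time with values in `L²`, with one constant for all `w`;
this controls the mixed term of the product rule. -/
lemma exists_norm_cutoff_sub_le {g : EuclideanSpace ℝ (Fin n) → ℝ}
    (hg : ContDiff ℝ ((⊤ : ℕ∞) : WithTop ℕ∞) g) (hgs : HasCompactSupport g) :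
    ∃ C : ℝ, ∀ (w : L2Space n) (s t : ℝ),
      ‖∫ η, w η * (cutoff (contDiff_schrodingerPhase s) hg hgs η -
        cutoff (contDiff_schrodingerPhase t) hg hgs η)‖ ≤ C * ‖w‖ * |s - t| := by
  refine ⟨(eLpNorm (cutoff contDiff_symbol hg hgs) 2 volume).toReal, fun w s t => ?_⟩
  have hmem : ∀ φ : 𝓢(EuclideanSpace ℝ (Fin n), ℂ), MemLp φ 2 volume := fun φ => φ.memLp 2 volume
  have hle : eLpNorm (fun η => cutoff (contDiff_schrodingerPhase s) hg hgs η -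
        cutoff (contDiff_schrodingerPhase t) hg hgs η) 2 volume ≤
      ENNReal.ofReal |s - t| * eLpNorm (cutoff contDiff_symbol hg hgs) 2 volume := by
    refine eLpNorm_le_mul_eLpNorm_of_ae_le_mul (Filter.Eventually.of_forall fun η => ?_) 2
    simp only [cutoff_apply]
    rw [← sub_mul, norm_mul, norm_mul, ← mul_assoc]
    gcongr
    refine (norm_schrodingerPhase_sub_le s t η).trans_eq ?_
    rw [norm_real, Real.norm_of_nonneg (by positivity)]
  have h1 := norm_integral_mul_le ((hmem (cutoff (contDiff_schrodingerPhase s) hg hgs)).sub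
    (hmem (cutoff (contDiff_schrodingerPhase t) hg hgs))) w
  refine h1.trans ?_
  have h2 := ENNReal.toReal_mono (ENNReal.mul_ne_top ENNReal.ofReal_ne_top (hmem _).2.ne) hle
  rw [ENNReal.toReal_mul, ENNReal.toReal_ofReal (abs_nonneg _)] at h2
  refine (mul_le_mul_of_nonneg_left h2 (norm_nonneg w)).trans_eq ?_
  ring

/-- The Fourier transform of the free solution is obtained by multiplication with a phase. -/
theorem IsFreeSchrodingerSolution.isChirp {u₀ : L2Space n} {u : ℝ → L2Space n}
    (hu : IsFreeSchrodingerSolution u₀ u) {t : ℝ} (ht : 0 ≤ t) :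
    IsChirp (𝓕 u₀) (4 * Real.pi ^ 2 * t) (u t) := by
  have hint : ∀ (v : L2Space n) (φ : 𝓢(EuclideanSpace ℝ (Fin n), ℂ)),
      Integrable fun η => v η * φ η :=
    fun v φ => (Lp.memLp v).integrable_mul (φ.memLp 2 volume)
  have hcont : ContinuousOn (fun s => (𝓕 (u s) : L2Space n)) (Set.Ici 0) :=
    (Lp.fourierTransformₗᵢ (EuclideanSpace ℝ (Fin n)) ℂ).continuous.comp_continuousOn
      hu.continuousOn
  have key : ∀ g : EuclideanSpace ℝ (Fin n) → ℝ,
      ∀ (hg : ContDiff ℝ ((⊤ : ℕ∞) : WithTop ℕ∞) g) (hgs : HasCompactSupport g), ∀ t, 0 ≤ t →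
      ∫ η, (𝓕 (u t) : L2Space n) η * cutoff (contDiff_schrodingerPhase t) hg hgs η =
      ∫ η, (𝓕 (u 0) : L2Space n) η * cutoff (contDiff_schrodingerPhase 0) hg hgs η := by
    intro g hg hgs
    set H : ℝ → ℂ := fun s =>
      ∫ η, (𝓕 (u s) : L2Space n) η * cutoff (contDiff_schrodingerPhase s) hg hgs η with hH
    obtain ⟨C, hC⟩ := exists_norm_cutoff_sub_le hg hgs
    -- Product rule for the pairing of two time-dependent factors: freeze each one in turn and keep
    -- the product of the two increments as remainder.
    have hdecomp : ∀ s t, H s =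
        ((∫ η, (𝓕 (u s) : L2Space n) η * cutoff (contDiff_schrodingerPhase t) hg hgs η) +
        (∫ η, (𝓕 (u t) : L2Space n) η * cutoff (contDiff_schrodingerPhase s) hg hgs η) - H t) +
        ∫ η, (𝓕 (u s) - 𝓕 (u t) : L2Space n) η *
          (cutoff (contDiff_schrodingerPhase s) hg hgs η -
            cutoff (contDiff_schrodingerPhase t) hg hgs η) := by
      intro s t
      have h1 : ∫ η, (𝓕 (u s) - 𝓕 (u t) : L2Space n) η *
          (cutoff (contDiff_schrodingerPhase s) hg hgs η -
            cutoff (contDiff_schrodingerPhase t) hg hgs η) =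
          ∫ η, (((𝓕 (u s) : L2Space n) η * cutoff (contDiff_schrodingerPhase s) hg hgs η -
            (𝓕 (u s) : L2Space n) η * cutoff (contDiff_schrodingerPhase t) hg hgs η) -
            ((𝓕 (u t) : L2Space n) η * cutoff (contDiff_schrodingerPhase s) hg hgs η -
            (𝓕 (u t) : L2Space n) η * cutoff (contDiff_schrodingerPhase t) hg hgs η)) := by
        refine integral_congr_ae ?_
        filter_upwards [Lp.coeFn_sub (𝓕 (u s) : L2Space n) (𝓕 (u t))] with η hη
        rw [hη, Pi.sub_apply]
        ring
      have h2 : ∀ φ χ : 𝓢(EuclideanSpace ℝ (Fin n), ℂ), ∫ η,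
          (((𝓕 (u s) : L2Space n) η * φ η - (𝓕 (u s) : L2Space n) η * χ η) -
            ((𝓕 (u t) : L2Space n) η * φ η - (𝓕 (u t) : L2Space n) η * χ η)) =
          ((∫ η, (𝓕 (u s) : L2Space n) η * φ η) - ∫ η, (𝓕 (u s) : L2Space n) η * χ η) -
          ((∫ η, (𝓕 (u t) : L2Space n) η * φ η) - ∫ η, (𝓕 (u t) : L2Space n) η * χ η) := by
        intro φ χ
        rw [← integral_sub (hint _ _) (hint _ _), ← integral_sub (hint _ _) (hint _ _)]
        exact integral_sub ((hint _ _).sub (hint _ _)) ((hint _ _).sub (hint _ _))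
      rw [h1, h2]
      simp only [hH]
      ring
    have hderiv : ∀ t, 0 < t → HasDerivAt H 0 t := by
      intro t ht
      set ψ := cutoff (contDiff_schrodingerPhase t) hg hgs with hψ
      set χ : 𝓢(EuclideanSpace ℝ (Fin n), ℂ) :=
        cutoff (contDiff_symbol.neg.mul (contDiff_schrodingerPhase t)) hg hgs with hχ
      have hlap : Δ (𝓕 ψ) = 𝓕 χ := by
        refine laplacian_fourier ψ χ fun η => ?_
        simp only [hψ, hχ, cutoff_apply]
        push_cast
        ring
      have h1 := hu.equation (𝓕 ψ) t ht
      simp_rw [hlap, ← integral_fourier_mul_schwartz] at h1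
      have h2 := hasDerivAt_integral_phase (𝓕 (u t) : L2Space n) hg hgs t
      -- Continuity of `u` makes one increment `o(1)` and the other is `O(|s - t|)`;
      -- differentiability of `u` in `L²` is not required.
      have h3 : HasDerivAt (fun s => ∫ η, (𝓕 (u s) - 𝓕 (u t) : L2Space n) η *
          (cutoff (contDiff_schrodingerPhase s) hg hgs η -
            cutoff (contDiff_schrodingerPhase t) hg hgs η)) 0 t := by
        rw [hasDerivAt_iff_isLittleO]
        simp only [sub_self, mul_zero, integral_zero, sub_zero, smul_zero]
        have h4 : (fun s => C * ‖(𝓕 (u s) - 𝓕 (u t) : L2Space n)‖) =o[nhds t]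
            (fun _ => (1 : ℝ)) := by
          rw [Asymptotics.isLittleO_one_iff]
          have h5 : ContinuousAt (fun s => (𝓕 (u s) : L2Space n)) t :=
            hcont.continuousAt (Ici_mem_nhds ht)
          have h6 := ((h5.sub continuousAt_const : ContinuousAt (fun s =>
            (𝓕 (u s) - 𝓕 (u t) : L2Space n)) t).norm.const_mul C).tendsto
          simpa using h6
        have h7 := h4.mul_isBigO (Asymptotics.isBigO_refl (fun s => s - t) (nhds t))
        simp only [one_mul] at h7
        refine Asymptotics.IsBigO.trans_isLittleO
          (Asymptotics.IsBigO.of_bound 1 (Filter.Eventually.of_forall fun s => ?_)) h7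
        rw [one_mul, norm_mul, Real.norm_eq_abs (s - t)]
        refine (hC _ s t).trans ?_
        gcongr
        exact le_abs_self _
      have h8 := ((h1.add h2).sub_const (H t)).add h3
      refine (h8.congr_of_eventuallyEq
        (Filter.Eventually.of_forall fun s => hdecomp s t)).congr_deriv ?_
      rw [add_zero, ← integral_const_mul, ← integral_add ((hint _ _).const_mul _)]
      · refine (integral_congr_ae (Filter.Eventually.of_forall fun η => ?_)).trans
          (integral_zero _ _)
        simp only [hχ, cutoff_apply]
        push_cast
        ring
      · refine ((hint (𝓕 (u t)) χ).const_mul (-I)).congr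
          (Filter.Eventually.of_forall fun η => ?_)
        simp only [hχ, cutoff_apply]
        push_cast
        ring
    have hconst : ∀ s t, 0 < s → 0 < t → H s = H t := by
      intro s t hs ht
      refine (convex_Ioi (0 : ℝ)).is_const_of_fderivWithin_eq_zero (𝕜 := ℝ) (f := H)
        (fun x hx => (hderiv x hx).differentiableAt.differentiableWithinAt) (fun x hx => ?_) hs ht
      rw [fderivWithin_of_isOpen isOpen_Ioi hx]
      ext
      simp [(hderiv x hx).deriv]
    -- The equation holds only for positive times, so the initial value is reached by continuity
    -- from the right.
    have hlim : Filter.Tendsto H (nhdsWithin 0 (Set.Ioi 0)) (nhds (H 0)) := by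
      have h1 : Filter.Tendsto (fun s =>
          ∫ η, (𝓕 (u s) : L2Space n) η * cutoff (contDiff_schrodingerPhase 0) hg hgs η)
          (nhdsWithin 0 (Set.Ioi 0)) (nhds (H 0)) := by
        have h2 := (continuous_integral_mul ((cutoff (contDiff_schrodingerPhase 0) hg hgs).memLp 2
          volume)).comp_continuousOn hcont
        exact ((h2 0 Set.self_mem_Ici).mono Set.Ioi_subset_Ici_self).tendsto
      have h2 : Filter.Tendsto (fun s => ∫ η, (𝓕 (u 0) : L2Space n) η *
          cutoff (contDiff_schrodingerPhase s) hg hgs η)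
          (nhdsWithin 0 (Set.Ioi 0)) (nhds (H 0)) :=
        (hasDerivAt_integral_phase (𝓕 (u 0) : L2Space n) hg hgs 0).continuousAt.tendsto.mono_left
          nhdsWithin_le_nhds
      have h3 : Filter.Tendsto (fun s => ∫ η, (𝓕 (u s) - 𝓕 (u 0) : L2Space n) η *
          (cutoff (contDiff_schrodingerPhase s) hg hgs η -
            cutoff (contDiff_schrodingerPhase 0) hg hgs η))
          (nhdsWithin 0 (Set.Ioi 0)) (nhds 0) := by
        have h4 : Filter.Tendsto (fun s => C * ‖(𝓕 (u s) - 𝓕 (u 0) : L2Space n)‖ * |s - 0|)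
            (nhdsWithin 0 (Set.Ioi 0)) (nhds 0) := by
          have h5 : ContinuousWithinAt (fun s =>
              C * ‖(𝓕 (u s) - 𝓕 (u 0) : L2Space n)‖ * |s - 0|) (Set.Ici 0) 0 :=
            (continuousWithinAt_const.mul
              ((hcont 0 Set.self_mem_Ici).sub continuousWithinAt_const).norm).mul
              (by fun_prop : Continuous fun s : ℝ => |s - 0|).continuousWithinAt
          simpa using (h5.mono Set.Ioi_subset_Ici_self).tendsto
        exact squeeze_zero_norm (fun s => hC _ s 0) h4
      have h4 := ((h1.add h2).sub_const (H 0)).add h3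
      simp only [add_sub_cancel_right, add_zero] at h4
      exact h4.congr fun s => (hdecomp s 0).symm
    intro t ht
    rcases ht.eq_or_lt with rfl | ht
    · rfl
    refine tendsto_nhds_unique (tendsto_const_nhds.congr' ?_) hlim
    filter_upwards [self_mem_nhdsWithin] with s hs
    exact hconst t s ht hs
  have hphase : MemLp (fun η => schrodingerPhase t η * (𝓕 (u t) : L2Space n) η) 2 := by
    refine (Lp.memLp (𝓕 (u t) : L2Space n)).of_le
      ((contDiff_schrodingerPhase t).continuous.aestronglyMeasurable.mul
        (Lp.aestronglyMeasurable _)) (Filter.Eventually.of_forall fun η => ?_)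
    rw [norm_mul, norm_schrodingerPhase, one_mul]
  have hz := ae_eq_zero_of_integral_contDiff_smul_eq_zero
    (f := fun η => schrodingerPhase t η * (𝓕 (u t) : L2Space n) η - (𝓕 (u 0) : L2Space n) η)
    ((hphase.sub (Lp.memLp _)).locallyIntegrable one_le_two) fun g hg hgs => by
      have h1 := key g hg hgs t ht
      rw [← sub_eq_zero, ← integral_sub (hint _ _) (hint _ _)] at h1
      rw [← h1]
      refine integral_congr_ae (Filter.Eventually.of_forall fun η => ?_)
      simp only [cutoff_apply, schrodingerPhase_zero, real_smul]
      ring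
  rw [IsChirp, ← hu.initial]
  filter_upwards [hz] with η hη
  rw [← sub_eq_zero.1 hη, ← mul_assoc, schrodingerPhase, ← Complex.exp_add]
  have : -(I * ((4 * Real.pi ^ 2 * t : ℝ) : ℂ) * (‖η‖ : ℂ) ^ 2) +
      I * ((t * (4 * Real.pi ^ 2 * ‖η‖ ^ 2) : ℝ) : ℂ) = 0 := by
    push_cast
    ring
  rw [this, Complex.exp_zero, one_mul]

end Evolution

/-! ### Change of Fourier normalization -/

section AngularFourier

variable {n : ℕ}

/-- The angular-frequency normalization turns into a rescaling of the weight. -/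
lemma gaussianNorm_angularFourier (c : Fin n → ℝ) (f : L2Space n) :
    gaussianNorm c (angularFourier f) =
      gaussianNorm (fun j => c j * (2 * Real.pi) ^ 2) (𝓕 f : L2Space n) := by
  have hpi : 0 < 2 * Real.pi := Real.two_pi_pos
  set G : EuclideanSpace ℝ (Fin n) → ℂ := fun x =>
    ((Real.exp (∑ j, c j * (2 * Real.pi) ^ 2 * x j ^ 2) : ℝ) : ℂ) * (𝓕 f : L2Space n) x with hG
  have h1 : (fun ξ : EuclideanSpace ℝ (Fin n) =>
      ((Real.exp (∑ j, c j * ξ j ^ 2) : ℝ) : ℂ) * angularFourier f ξ) =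
      (((2 * Real.pi) ^ (-(n : ℝ) / 2) : ℝ) : ℂ) • (G ∘ fun ξ => (2 * Real.pi)⁻¹ • ξ) := by
    ext ξ
    have h2 : ∀ j, c j * (2 * Real.pi) ^ 2 * ((2 * Real.pi)⁻¹ * ξ j) ^ 2 = c j * ξ j ^ 2 := by
      intro j
      field_simp
    simp only [hG, angularFourier, Pi.smul_apply, Function.comp_apply, PiLp.smul_apply,
      smul_eq_mul, h2]
    ring
  have hr : (2 * Real.pi)⁻¹ ≠ 0 := by positivity
  have h3 : eLpNorm (G ∘ fun ξ => (2 * Real.pi)⁻¹ • ξ) 2 volume =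
      eLpNorm G 2 (Measure.map (fun ξ => (2 * Real.pi)⁻¹ • ξ) volume) :=
    ((Homeomorph.smulOfNeZero _ hr).measurableEmbedding.eLpNorm_map_measure).symm
  rw [gaussianNorm, gaussianNorm, h1, eLpNorm_const_smul, h3, Measure.map_addHaar_smul _ hr,
    eLpNorm_smul_measure_of_ne_top ENNReal.ofNat_ne_top, smul_eq_mul, ← mul_assoc,
    finrank_euclideanSpace_fin]
  have h4 : |((2 * Real.pi)⁻¹ ^ n)⁻¹| = (2 * Real.pi) ^ (n : ℝ) := by
    rw [abs_of_nonneg (by positivity), inv_pow, inv_inv, Real.rpow_natCast]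
  -- The square root of the Jacobian `(2π)^n` cancels the normalizing constant.
  have h5 : ‖(((2 * Real.pi) ^ (-(n : ℝ) / 2) : ℝ) : ℂ)‖ₑ *
      ENNReal.ofReal |((2 * Real.pi)⁻¹ ^ n)⁻¹| ^ (1 / (2 : ℝ≥0∞)).toReal = 1 := by
    rw [h4, ← ofReal_norm, Complex.norm_real, Real.norm_of_nonneg (by positivity),
      ENNReal.toReal_div, ENNReal.toReal_ofNat, ENNReal.ofReal_rpow_of_nonneg (by positivity) (by positivity),
      ← ENNReal.ofReal_mul (by positivity), ← Real.rpow_mul hpi.le, ← Real.rpow_add hpi]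
    simp
    ring_nf
    simp
  rw [h5, one_mul]

end AngularFourier

/-! ### The two inequalities -/

theorem corollary3p1 (n : ℕ) (α β : ℝ) (hα : 0 < α) (hβ : 0 < β)
    (u₀ : L2Space n) (u : ℝ → L2Space n) (hu : IsFreeSchrodingerSolution u₀ u)
    (γ : Fin n → ℝ) (hγ : ∀ j, 0 ≤ γ j) :
    (∀ T : ℝ, 0 < T → ∀ t : ℝ, 0 ≤ t → t ≤ T →
      gaussianNorm (fun j => γ j / (α * t + β) ^ 2) (u t) ≤
        gaussianNorm (fun j => γ j / β ^ 2) (u 0) ^ (β * (T - t) / (T * (α * t + β))) *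
        gaussianNorm (fun j => γ j / (α * T + β) ^ 2) (u T) ^
          (1 - β * (T - t) / (T * (α * t + β)))) ∧
    (∀ t : ℝ, 0 ≤ t →
      gaussianNorm (fun j => γ j / (α * t + β) ^ 2) (u t) ≤
        gaussianNorm (fun j => γ j / β ^ 2) (u 0) ^ (β / (α * t + β)) *
        gaussianNorm (fun j => 4 * γ j / α ^ 2) (angularFourier (u 0)) ^
          (1 - β / (α * t + β))) := by
  lift γ to Fin n → NNReal using hγ
  have hweight : ∀ (a : ℝ), (fun j => (γ j : ℝ) / a ^ 2) = fun j => (γ j : ℝ) * (1 / a) ^ 2 := by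
    intro a
    ext j
    rw [one_div, inv_pow, div_eq_mul_inv]
  have hm : ∀ U : L2Space n, AEStronglyMeasurable U volume := fun U => Lp.aestronglyMeasurable U
  constructor
  · intro T hT t ht htT
    have hαt : 0 < α * t + β := by positivity
    have hαT : 0 < α * T + β := by positivity
    -- At the endpoints an exponent is 0 and the claim is an equality; the convexity lemmas need `0
    -- < θ < 1`.
    rcases ht.eq_or_lt with rfl | ht
    · have h1 : β * (T - 0) / (T * (α * 0 + β)) = 1 := by field_simp; ring
      rw [h1]
      simp
    rcases htT.eq_or_lt with rfl | htT
    · simp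
    set θ : ℝ := 1 - β * (T - t) / (T * (α * t + β)) with hθ
    have hθ₁ : θ < 1 := by
      have : 0 < β * (T - t) / (T * (α * t + β)) := by
        have := sub_pos.2 htT
        positivity
      linarith
    have hθ' : θ = t * (α * T + β) / (T * (α * t + β)) := by
      rw [hθ]
      field_simp
      ring
    have hθ₀ : 0 < θ := by rw [hθ']; positivity
    rw [show β * (T - t) / (T * (α * t + β)) = 1 - θ by rw [hθ]; ring, hweight, hweight, hweight]
    refine gaussianNorm_le_of_linearNorm_le γ hθ₀.le hθ₁.le (hm _) (hm _) (hm _) fun s => ?_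
    -- With `r = 1/(αt+β)`, the two remaining identities place `(r, t r)` on the segment between
    -- times `0` and `T`, at parameter `θ`.
    refine linearNorm_convex_time (hu.isChirp le_rfl) (hu.isChirp hT.le) (hu.isChirp ht.le)
      hθ₀ hθ₁ ?_ ?_ s
    · rw [hθ']
      field_simp
      ring
    · rw [hθ']
      field_simp
      ring
  · intro t ht
    have hαt : 0 < α * t + β := by positivity
    rcases ht.eq_or_lt with rfl | ht
    · have h1 : β / (α * 0 + β) = 1 := by field_simp; ring
      rw [h1]
      simp
    set θ : ℝ := 1 - β / (α * t + β) with hθ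
    have hθ₁ : θ < 1 := by
      have : 0 < β / (α * t + β) := by positivity
      linarith
    have hθ' : θ = α * t / (α * t + β) := by
      rw [hθ]
      field_simp
      ring
    have hθ₀ : 0 < θ := by rw [hθ']; positivity
    -- The endpoint `r = 0`, `t r = 1/α` of the line, in Mathlib's frequency variable, is the weight
    -- with `r₁ = 4π/α`, since `π r₁ = 4π²/α`.
    have hfreq : (fun j => 4 * (γ j : ℝ) / α ^ 2 * (2 * Real.pi) ^ 2) =
        fun j => (γ j : ℝ) * (4 * Real.pi / α) ^ 2 := by
      ext j
      field_simp
      ring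
    rw [show β / (α * t + β) = 1 - θ by rw [hθ]; ring, gaussianNorm_angularFourier, hfreq,
      hweight, hweight]
    refine gaussianNorm_le_of_linearNorm_le γ hθ₀.le hθ₁.le (hm _) (hm _) (hm _) fun s => ?_
    rw [hu.initial]
    refine linearNorm_convex_frequency (hu.initial ▸ hu.isChirp le_rfl) (hu.isChirp ht.le)
      hθ₀ hθ₁ ?_ ?_ s
    · rw [hθ']
      field_simp
      ring
    · rw [hθ']
      field_simp
      ring
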